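/- Let $S=\mathbf{C}[z_0,z_1,z_2]$, let $S_d$ be the space of forms of degree $d$ (so $S_d=0$ for $d<0$), and let $J\subset S$ be the homogeneous saturated ideal of a (nonempty) zero-dimensional subscheme of $\mathbf{P}^2$. Let \[ 0\to \bigoplus_{i=1}^t S(-b_i)\to\bigoplus_{i=1}^{t+1}S(-a_i)\to S\to S/J\to 0 \] be a minimal graded free resolution of $S/J$. For a zero-dimensional scheme $Z\subset\mathbf{P}^2$ and $d\in\mathbf{Z}$, the defect of the linear system of degree $d$ polynomials vanishing along $Z$ is the dimension of the cokernel of the evaluation map $S_d\to H^0(Z,\mathcal{O}_Z(d))$. For $g_0,g_1,g_2\in S_m$ let $\varphi=(g_0:g_1:g_2)$ and let $\varphi^*(J)\subset S$ be the ideal generated by all $F(g_0,g_1,g_2)$ with $F\in J$. "For general $g_0,g_1,g_2\in S_m$" means: for all $(g_0,g_1,g_2)$ in some nonempty Zariski open subset of $(S_m)^3$ (which may depend on $m$); for general $g_0,g_1,g_2$ the map $\varphi:\mathbf{P}^2\to\mathbf{P}^2$ is a morphism and $Z(\varphi^*(J))$ is zero-dimensional. Suppose that there are an integer $n$ and a linear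 function $g(m)=\alpha m+\beta$ ($\alpha,\beta\in\mathbf{R}$) such that for all positive integers $m$ and for general $g_0,g_1,g_2\in S_m$ the defect $\delta_m$ of the linear system of degree $mn-3$ polynomials vanishing along $Z(\varphi^*(J))$ is at most $g(m)$. Then $b_i\le n$ for $i=1,\dots,t$, $a_i<n$ for $i=1,\dots,t+1$, and for all positive integers $m$ and for general $g_0,g_1,g_2\in S_m$ one has $\delta_m=\#\{i\mid b_i=n\}$. -/

import Mathlib

open MvPolynomial

noncomputable section

namespace PlaneScheme

/-- The homogeneous coordinate ring `S = ℂ[z₀, z₁, z₂]` of the projective plane. -/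
abbrev S : Type := MvPolynomial (Fin 3) ℂ

/-- The projective plane over `ℂ` (its closed points). -/
abbrev P2 : Type := Projectivization ℂ (Fin 3 → ℂ)

/-- The space `S_d` of forms of degree `d`, for an integer `d`; it is zero for `d < 0`. -/
abbrev forms (d : ℤ) : Submodule ℂ S :=
  weightedHomogeneousSubmodule ℂ (fun _ : Fin 3 => (1 : ℤ)) d

/-- The set of closed points of the scheme `Z(K)` of a homogeneous ideal `K`. -/
def points (K : Ideal S) : Set P2 :=
  {p | ∀ f ∈ K, eval p.rep f = 0}

/-- `J` is the ideal of a zero-dimensional subscheme of the plane: it is homogeneous, saturated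
with respect to the irrelevant ideal, and its scheme has at least one and only finitely many
closed points. -/
structure IsIdealOfZeroDimScheme (J : Ideal S) : Prop where
  homogeneous : ∀ f ∈ J, ∀ d : ℕ, homogeneousComponent d f ∈ J
  saturated : ∀ f : S, (∀ i : Fin 3, X i * f ∈ J) → f ∈ J
  nonempty : (points J).Nonempty
  finite : (points J).Finite

/-- The row `f` of `t + 1` forms and the matrix `M` are the maps of a minimal graded free resolution
`0 → ⨁ⱼ S(-b j) → ⨁ᵢ S(-a i) → S → S/J → 0`. -/
structure IsMinimalResolution (J : Ideal S) {t : ℕ} (a : Fin (t + 1) → ℤ) (b : Fin t → ℤ)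
    (f : Fin (t + 1) → S) (M : Matrix (Fin (t + 1)) (Fin t) S) : Prop where
  /-- The maps preserve degrees. -/
  degree_f : ∀ i, f i ∈ forms (a i)
  degree_M : ∀ i j, M i j ∈ forms (b j - a i)
  /-- Exactness at the three places. -/
  span_f : Ideal.span (Set.range f) = J
  exact : Function.Exact M.mulVecLin (Fintype.linearCombination S f)
  injective : Function.Injective M.mulVecLin
  /-- Minimality: all entries lie in the irrelevant ideal `(z₀, z₁, z₂)`. -/
  minimal_f : ∀ i, constantCoeff (f i) = 0
  minimal_M : ∀ i j, constantCoeff (M i j) = 0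

/-- The forms (of any degree) that vanish at no point of `Z(K)`. -/
def nonvanishing (K : Ideal S) : Submonoid S where
  carrier := {h | (∃ e : ℤ, h ∈ forms e) ∧ ∀ p ∈ points K, eval p.rep h ≠ 0}
  one_mem' := ⟨⟨0, isWeightedHomogeneous_one ℂ _⟩, fun p _ => by simp⟩
  mul_mem' := by
    rintro x y ⟨⟨d, hx⟩, hx'⟩ ⟨⟨e, hy⟩, hy'⟩
    refine ⟨⟨d + e, IsWeightedHomogeneous.mul hx hy⟩, fun p hp => ?_⟩
    rw [map_mul]
    exact mul_ne_zero (hx' p hp) (hy' p hp)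

/-- The localization of `S/K` at the forms that vanish at no point of `Z(K)`. -/
abbrev LocRing (K : Ideal S) : Type :=
  Localization ((nonvanishing K).map (Ideal.Quotient.mk K))

/-- The canonical map `S → S/K → LocRing K`. -/
def toLoc (K : Ideal S) : S →ₐ[ℂ] LocRing K :=
  (IsScalarTower.toAlgHom ℂ (S ⧸ K) (LocRing K)).comp (Ideal.Quotient.mkₐ ℂ K)

/-- The space `H⁰(Z, 𝒪_Z(d))` of global sections for a zero-dimensional scheme `Z = Z(K)`:
fractions `f/h` of forms modulo `K` with `deg f - deg h = d`, where `h` vanishes at no point of `Z`.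
(As `Z` is finite, it lies in the affine open set `h ≠ 0` of a form `h`, and these
fractions are all the sections.) -/
def sections (K : Ideal S) (d : ℤ) : Submodule ℂ (LocRing K) where
  carrier := {x | ∃ e : ℤ, ∃ h ∈ nonvanishing K, ∃ f ∈ forms (d + e),
    h ∈ forms e ∧ toLoc K h * x = toLoc K f}
  zero_mem' := ⟨0, 1, one_mem _, 0, zero_mem _, isWeightedHomogeneous_one ℂ _, by simp⟩
  add_mem' := by
    rintro x y ⟨e, h, hh, f, hf, hd, hx⟩ ⟨e', h', hh', f', hf', hd', hy⟩
    refine ⟨e + e', h * h', mul_mem hh hh', f * h' + h * f', ?_,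
      IsWeightedHomogeneous.mul hd hd', ?_⟩
    · refine add_mem ?_ ?_
      · have := IsWeightedHomogeneous.mul hf hd'
        rwa [show d + e + e' = d + (e + e') by ring] at this
      · have := IsWeightedHomogeneous.mul hd hf'
        rwa [show e + (d + e') = d + (e + e') by ring] at this
    · simp only [map_mul, map_add, ← hx, ← hy]
      ring
  smul_mem' := by
    rintro c x ⟨e, h, hh, f, hf, hd, hx⟩
    refine ⟨e, h, hh, c • f, Submodule.smul_mem _ c hf, hd, ?_⟩
    rw [map_smul, ← hx, mul_smul_comm]

/-- The defect of the linear system of forms of degree `d` vanishing along `Z = Z(K)`: the dimension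
of the cokernel of the evaluation map `S_d → H⁰(Z, 𝒪_Z(d))`. -/
def defect (K : Ideal S) (d : ℤ) : ℕ :=
  Module.finrank ℂ
    (sections K d ⧸ ((forms d).map (toLoc K).toLinearMap).submoduleOf (sections K d))

/-- The ideal of the pullback of `Z(J)` along `(z₀ : z₁ : z₂) ↦ (g₀ : g₁ : g₂)`. -/
def pullback (g : Fin 3 → S) (J : Ideal S) : Ideal S :=
  J.map (aeval g : S →ₐ[ℂ] S)

/-- The property `Q` holds for a general triple of forms of degree `m`: it holds on a nonempty
Zariski open subset of `(S_m)³`, here the set where some polynomial `P` in the coefficients of the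
three forms, not identically zero on `(S_m)³`, is nonzero. -/
def ForGeneral (m : ℕ) (Q : (Fin 3 → S) → Prop) : Prop :=
  ∃ P : MvPolynomial (Fin 3 × (Fin 3 →₀ ℕ)) ℂ,
    (∃ g : Fin 3 → S, (∀ i, (g i).IsHomogeneous m) ∧
      eval (fun q => coeff q.2 (g q.1)) P ≠ 0) ∧
    ∀ g : Fin 3 → S, (∀ i, (g i).IsHomogeneous m) →
      eval (fun q => coeff q.2 (g q.1)) P ≠ 0 → Q g

end PlaneScheme

end

/-!
For general forms `g₀, g₁, g₂` of degree `m`, the ring `S` is free over itself via `F ↦ F(g)`, with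
basis the monomials `z^e` with all `eᵢ < m`: this is an open condition on `g`, and it holds for
`gᵢ = zᵢ^m`. If `L` is a form that vanishes nowhere on `Z(K)` and is a non-zero-divisor on `S/K`,
then multiplication by a high power of `L` identifies the sections on `Z(K)` with forms modulo `K`,
so the Hilbert function of `S/K` plus the defect of `Z(K)` is a value of the Hilbert function in a
high degree. Consequently the defect of `Z(φ^* J)` in degree `d` is the sum, over the `e` with
`m ∣ d - |e|`, of the defects of `Z(J)` in degree `(d - |e|) / m`.

In degree `mn - 3` the basis monomials with `|e| = 2m - 3`, of which there are at least `m² / 4` for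
even `m`, contribute the defect of `Z(J)` in degree `n - 2`, so a linear bound forces that defect to
vanish. Then only `e = (m - 1, m - 1, m - 1)` survives, and it contributes the defect of `Z(J)` in
degree `n - 3`.

By exactness the third difference at `d - 3` of the Hilbert function of `S/J` is, for `d > 0`, the
number of `j` with `b j = d` minus the number of `i` with `a i = d`. The Hilbert function plus the
defect is constant, so for `d ≥ n` this difference is the defect in degree `d - 3`. Minimality puts
every `a i` below some `b j`, and the degree bounds follow.
-/

noncomputable section

namespace PlaneScheme

section WeightedHomogeneous

variable {σ τ R M : Type*} [CommSemiring R]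

lemma weightedHomogeneousComponent_mul_of_mem [AddCommGroup M] {w : σ → M} {e : M}
    {G : MvPolynomial σ R} (hG : IsWeightedHomogeneous w G e) (d : M) (F : MvPolynomial σ R) :
    weightedHomogeneousComponent w d (G * F) = G * weightedHomogeneousComponent w (d - e) F := by
  classical
  let _ := weightedGradedAlgebra R w
  have h := DirectSum.coe_decompose_mul_add_of_left_mem (weightedHomogeneousSubmodule R w)
    (b := F) (j := d - e) hG
  rw [add_sub_cancel] at h
  exact (weightedDecomposition.decompose'_apply R w (G * F) d).symm.trans
    (h.trans (congrArg (G * ·) (weightedDecomposition.decompose'_apply R w F (d - e))))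

lemma weightedHomogeneousComponent_aeval [AddCommMonoid M] {v : σ → M} {w : τ → M}
    {g : σ → MvPolynomial τ R} (hg : ∀ i, IsWeightedHomogeneous w (g i) (v i)) (c : M)
    (F : MvPolynomial σ R) :
    weightedHomogeneousComponent w c (aeval g F) =
      aeval g (weightedHomogeneousComponent v c F) := by
  classical
  have haeval (α : σ →₀ ℕ) (r : R) :
      IsWeightedHomogeneous w (aeval g (monomial α r)) (Finsupp.weight v α) := by
    rw [aeval_monomial, Finsupp.weight_apply, algebraMap_eq]
    exact (IsWeightedHomogeneous.prod _ _ _ fun i _ => (hg i).pow (α i)).C_mul r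
  induction F using MvPolynomial.induction_on' with
  | monomial α r =>
    rw [weightedHomogeneousComponent_of_mem (haeval α r),
      weightedHomogeneousComponent_of_mem (isWeightedHomogeneous_monomial v α r rfl)]
    split_ifs <;> simp
  | add F G hF hG => simp only [map_add, hF, hG]

/-- The space of polynomials that are homogeneous of degree `c` when all variables have weight `w`.
Weight `1` gives the forms of degree `c`; for `w = m` the substitution of forms of degree `m` for
the variables preserves degrees. -/
abbrev weightedForms (σ R : Type*) [CommSemiring R] (w c : ℤ) : Submodule R (MvPolynomial σ R) :=
  weightedHomogeneousSubmodule R (fun _ : σ => w) c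

/-- The component of degree `c` of a polynomial when all variables have weight `w`. -/
abbrev weightedPart (w c : ℤ) : MvPolynomial σ R →ₗ[R] MvPolynomial σ R :=
  weightedHomogeneousComponent (fun _ : σ => w) c

lemma weight_const (w : ℤ) (α : σ →₀ ℕ) :
    Finsupp.weight (fun _ : σ => w) α = α.degree * w := by
  rw [Finsupp.weight_apply, Finsupp.sum, Finsupp.degree_apply, Nat.cast_sum, Finset.sum_mul]
  simp

lemma mem_weightedForms {w c : ℤ} {F : MvPolynomial σ R} :
    F ∈ weightedForms σ R w c ↔ ∀ α, coeff α F ≠ 0 → (α.degree : ℤ) * w = c := by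
  simp [mem_weightedHomogeneousSubmodule, IsWeightedHomogeneous, weight_const]

lemma mem_weightedForms_iff_weightedPart_eq {w c : ℤ} {F : MvPolynomial σ R} :
    F ∈ weightedForms σ R w c ↔ weightedPart w c F = F :=
  ⟨fun hF => (weightedHomogeneousComponent_of_mem hF).trans (if_pos rfl), fun hF => hF ▸
    weightedHomogeneousComponent_isWeightedHomogeneous c F⟩

lemma weightedForms_mul {w : ℤ} (hw : w ≠ 0) (q : ℤ) :
    weightedForms σ R w (w * q) = weightedForms σ R 1 q := by
  ext F
  simp only [mem_weightedForms, mul_comm w q, mul_left_inj' hw, mul_one]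

lemma weightedForms_of_not_dvd {w c : ℤ} (h : ¬ w ∣ c) : weightedForms σ R w c = ⊥ := by
  refine (Submodule.eq_bot_iff _).2 fun F hF => ext _ _ fun α => ?_
  by_contra hα
  exact h (Dvd.intro_left _ (mem_weightedForms.1 hF α hα))

lemma weightedForms_one_of_neg {d : ℤ} (hd : d < 0) : weightedForms σ R 1 d = ⊥ := by
  refine (Submodule.eq_bot_iff _).2 fun F hF => ext _ _ fun α => ?_
  by_contra hα
  have := mem_weightedForms.1 hF α hα
  lia

lemma mem_weightedForms_one_natCast {d : ℕ} {F : MvPolynomial σ R} :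
    F ∈ weightedForms σ R 1 d ↔ F.IsHomogeneous d := by
  simp only [mem_weightedForms, mul_one, Nat.cast_inj, Finsupp.degree_eq_weight_one]
  rfl

lemma monomial_mem_weightedForms_one (α : σ →₀ ℕ) (r : R) :
    monomial α r ∈ weightedForms σ R 1 α.degree :=
  isWeightedHomogeneous_monomial _ _ _ (by rw [weight_const, mul_one])

end WeightedHomogeneous

section HomogeneousIdeal

attribute [local instance] MvPolynomial.gradedAlgebra

variable {σ τ R : Type*} [CommRing R]

lemma weightedPart_mem {K : Ideal (MvPolynomial σ R)}
    (hK : K.IsHomogeneous (homogeneousSubmodule σ R)) {F : MvPolynomial σ R} (hF : F ∈ K)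
    (w c : ℤ) : weightedPart w c F ∈ K := by
  rw [← sum_homogeneousComponent F, map_sum]
  refine sum_mem fun d _ => ?_
  have hd : homogeneousComponent d F ∈ weightedForms σ R w (d * w) :=
    mem_weightedForms.2 fun α hα => by
      rw [Finsupp.degree_eq_weight_one]
      exact congrArg (fun n : ℕ => n * w) (homogeneousComponent_isHomogeneous d F hα)
  rw [weightedHomogeneousComponent_of_mem hd]
  split_ifs
  · exact homogeneousComponent_mem_of_mem hK hF d
  · exact zero_mem K

lemma isHomogeneous_map_aeval {m : ℕ} {g : σ → MvPolynomial τ R}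
    (hg : ∀ i, (g i).IsHomogeneous m) {K : Ideal (MvPolynomial σ R)}
    (hK : K.IsHomogeneous (homogeneousSubmodule σ R)) :
    (K.map (aeval g)).IsHomogeneous (homogeneousSubmodule τ R) := by
  obtain ⟨s, rfl⟩ := (Ideal.IsHomogeneous.iff_exists _ K).1 hK
  rw [Ideal.map_span]
  refine Ideal.homogeneous_span _ _ ?_
  rintro _ ⟨_, ⟨F, -, rfl⟩, rfl⟩
  obtain ⟨d, hd⟩ := F.2
  exact ⟨m * d, IsHomogeneous.aeval hd g hg⟩

end HomogeneousIdeal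

section Dimension

open scoped fwdDiff

variable {σ R : Type*} [CommRing R]

lemma weightedForms_one_natCast (d : ℕ) :
    weightedForms σ R 1 d = homogeneousSubmodule σ R d :=
  Submodule.ext fun _ => mem_weightedForms_one_natCast

instance [Finite σ] (d : ℤ) : Module.Finite R (weightedForms σ R 1 d) := by
  rcases lt_or_ge d 0 with h | h
  · rw [weightedForms_one_of_neg h]
    infer_instance
  · lift d to ℕ using h
    rw [weightedForms_one_natCast]
    exact Module.Finite.iff_fg.2 (homogeneousSubmodule_fg σ R d)

lemma finite_weightedForms [Finite σ] {w : ℤ} (hw : w ≠ 0) (c : ℤ) :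
    Module.Finite R (weightedForms σ R w c) := by
  by_cases h : w ∣ c
  · obtain ⟨q, rfl⟩ := h
    rw [weightedForms_mul hw]
    infer_instance
  · rw [weightedForms_of_not_dvd h]
    infer_instance

variable [Fintype σ]

lemma finrank_weightedForms_one_natCast [Nontrivial R] (d : ℕ) :
    Module.finrank R (weightedForms σ R 1 d) = (Fintype.card σ).multichoose d := by
  classical
  have hset : {α : σ →₀ ℕ | α.degree = d} = (Finset.univ : Finset σ).finsuppAntidiag d := by
    ext α
    simp [Finset.mem_finsuppAntidiag, Finsupp.degree_eq_sum]
  rw [weightedForms_one_natCast, homogeneousSubmodule_eq_finsupp_supported,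
    ← restrictSupport,
    Module.finrank_eq_nat_card_basis (basisRestrictSupport R {α : σ →₀ ℕ | α.degree = d}),
    Nat.card_coe_set_eq, hset, Set.ncard_coe_finset,
    Finset.card_finsuppAntidiag_nat_eq_multichoose, Finset.card_univ]

lemma fwdDiff_iter_multichoose (n : ℕ) (d : ℤ) :
    (Δ_[1])^[n] (fun k : ℤ => if 0 ≤ k then (n.multichoose k.toNat : ℤ) else 0) d =
      if d + n = 0 then 1 else 0 := by
  induction n generalizing d with
  | zero =>
    obtain h | rfl | h := lt_trichotomy d 0
    · simp [h.not_ge, h.ne]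
    · simp
    · obtain ⟨k, rfl⟩ := Int.eq_succ_of_zero_lt h
      simp [Nat.multichoose_zero_succ, h.ne']
  | succ n ih =>
    have hstep : Δ_[1] (fun k : ℤ => if 0 ≤ k then ((n + 1).multichoose k.toNat : ℤ) else 0) =
        fun k => if 0 ≤ k + 1 then (n.multichoose (k + 1).toNat : ℤ) else 0 := by
      ext k
      rw [fwdDiff]
      obtain h | rfl | h := lt_trichotomy k (-1)
      · rw [if_neg (by lia), if_neg (by lia), if_neg (by lia), sub_zero]
      · simp
      · lift k to ℕ using (by lia)
        rw [if_pos (by lia), if_pos (by lia), if_pos (by lia), Int.toNat_natCast_add_one,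
          Int.toNat_natCast, Nat.multichoose_succ_succ]
        push_cast
        ring
    rw [Function.iterate_succ_apply, hstep,
      fwdDiff_iter_comp_add 1 (fun k : ℤ => if 0 ≤ k then (n.multichoose k.toNat : ℤ) else 0) 1, ih]
    push_cast
    congr 1
    rw [add_right_comm, add_assoc]

lemma fwdDiff_iter_finrank_weightedForms_one [Nontrivial R] (d : ℤ) :
    (Δ_[1])^[Fintype.card σ] (fun k : ℤ => (Module.finrank R (weightedForms σ R 1 k) : ℤ)) d =
      if d + Fintype.card σ = 0 then 1 else 0 := by
  rw [← fwdDiff_iter_multichoose]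
  refine congrFun (congrArg _ (funext fun k => ?_)) d
  rcases lt_or_ge k 0 with h | h
  · rw [weightedForms_one_of_neg h, finrank_bot, if_neg h.not_ge, Nat.cast_zero]
  · lift k to ℕ using h
    rw [finrank_weightedForms_one_natCast, if_pos (by positivity), Int.toNat_natCast]

end Dimension

section LinearAlgebra

lemma finrank_map_congr {R V W W' : Type*} [Ring R] [AddCommGroup V] [Module R V] [AddCommGroup W]
    [Module R W] [AddCommGroup W'] [Module R W'] {T : V →ₗ[R] W} {T' : V →ₗ[R] W'}
    {p : Submodule R V} (h : ∀ x ∈ p, T x = 0 ↔ T' x = 0) :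
    Module.finrank R (p.map T) = Module.finrank R (p.map T') := by
  have hker : (T.domRestrict p).ker = (T'.domRestrict p).ker := by
    ext x
    exact h x x.2
  rw [← LinearMap.range_domRestrict, ← LinearMap.range_domRestrict]
  exact (((T.domRestrict p).quotKerEquivRange.symm.trans
    (Submodule.quotEquivOfEq _ _ hker)).trans (T'.domRestrict p).quotKerEquivRange).finrank_eq

lemma finrank_map_add_finrank_ker_inf {k V W : Type*} [DivisionRing k] [AddCommGroup V]
    [Module k V] [AddCommGroup W] [Module k W] (T : V →ₗ[k] W) (p : Submodule k V)
    [FiniteDimensional k p] :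
    Module.finrank k (p.map T) + Module.finrank k (T.ker ⊓ p : Submodule k V) =
      Module.finrank k p := by
  rw [← LinearMap.finrank_range_add_finrank_ker (T.domRestrict p), LinearMap.range_domRestrict,
    LinearMap.ker_domRestrict, ← Submodule.finrank_map_subtype_eq p (T.ker.comap p.subtype),
    Submodule.map_comap_subtype, inf_comm]

lemma finrank_quotient_submoduleOf_add_finrank {k V : Type*} [DivisionRing k] [AddCommGroup V]
    [Module k V] {p q : Submodule k V} [FiniteDimensional k q] (h : p ≤ q) :
    Module.finrank k (q ⧸ p.submoduleOf q) + Module.finrank k p = Module.finrank k q := by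
  rw [← (Submodule.submoduleOfEquivOfLe h).finrank_eq]
  exact Submodule.finrank_quotient_add_finrank _

/-- A product of submodules is the product of the modules. -/
def piEquiv {ι R : Type*} {V : ι → Type*} [Semiring R] [∀ i, AddCommMonoid (V i)]
    [∀ i, Module R (V i)] (p : ∀ i, Submodule R (V i)) :
    (Submodule.pi Set.univ p) ≃ₗ[R] ∀ i, p i where
  toFun v i := ⟨v.1 i, v.2 i trivial⟩
  invFun v := ⟨fun i => v i, fun i _ => (v i).2⟩
  map_add' _ _ := rfl
  map_smul' _ _ := rfl

lemma map_compLeft_pi {ι R V W : Type*} [Semiring R] [AddCommMonoid V] [Module R V]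
    [AddCommMonoid W] [Module R W] (T : V →ₗ[R] W) (p : ι → Submodule R V) :
    (Submodule.pi Set.univ p).map (T.compLeft ι) = Submodule.pi Set.univ fun i => (p i).map T :=
  SetLike.coe_injective (Set.piMap_image_univ_pi (fun _ => T) fun i => (p i : Set V))

variable {ι k : Type*} {V : ι → Type*} [DivisionRing k] [∀ i, AddCommGroup (V i)]
  [∀ i, Module k (V i)] (p : ∀ i, Submodule k (V i)) [∀ i, FiniteDimensional k (p i)]

instance [Finite ι] : FiniteDimensional k (Submodule.pi Set.univ p) :=
  (piEquiv p).symm.finiteDimensional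

lemma finrank_submodule_pi [Fintype ι] :
    Module.finrank k (Submodule.pi Set.univ p) = ∑ i, Module.finrank k (p i) := by
  rw [(piEquiv p).finrank_eq, Module.finrank_pi_fintype]

end LinearAlgebra

section HilbertFunction

variable {σ k : Type*} [Field k]

/-- The Hilbert function of the quotient of the polynomial ring by `K`: the dimension of the space
of classes of forms of degree `d`. -/
def hilbertFunction (K : Ideal (MvPolynomial σ k)) (d : ℤ) : ℕ :=
  Module.finrank k ((weightedForms σ k 1 d).map (Ideal.Quotient.mkₐ k K).toLinearMap)

lemma hilbertFunction_eq_finrank_map {V : Type*} [AddCommGroup V] [Module k V]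
    {K : Ideal (MvPolynomial σ k)} {d : ℤ} {T : MvPolynomial σ k →ₗ[k] V}
    (hT : ∀ F ∈ weightedForms σ k 1 d, T F = 0 ↔ F ∈ K) :
    hilbertFunction K d = Module.finrank k ((weightedForms σ k 1 d).map T) :=
  finrank_map_congr fun F hF => by
    rw [hT F hF]
    exact Ideal.Quotient.eq_zero_iff_mem

lemma hilbertFunction_of_neg (K : Ideal (MvPolynomial σ k)) {d : ℤ} (hd : d < 0) :
    hilbertFunction K d = 0 := by
  rw [hilbertFunction, weightedForms_one_of_neg hd, Submodule.map_bot, finrank_bot]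

variable [Finite σ] {K : Ideal (MvPolynomial σ k)}

lemma hilbertFunction_add_finrank_inf (K : Ideal (MvPolynomial σ k)) (d : ℤ) :
    hilbertFunction K d + Module.finrank k
      (K.restrictScalars k ⊓ weightedForms σ k 1 d : Submodule k (MvPolynomial σ k)) =
        Module.finrank k (weightedForms σ k 1 d) := by
  have hker : K.restrictScalars k = (Ideal.Quotient.mkₐ k K).toLinearMap.ker :=
    Submodule.ext fun _ => Ideal.Quotient.eq_zero_iff_mem.symm
  rw [hker, hilbertFunction]
  exact finrank_map_add_finrank_ker_inf _ _

lemma hilbertFunction_le_add {L : MvPolynomial σ k} {e : ℤ} (hL : L ∈ weightedForms σ k 1 e)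
    (hdvd : ∀ F, L * F ∈ K → F ∈ K) (d : ℤ) : hilbertFunction K d ≤ hilbertFunction K (e + d) := by
  have hT : ∀ F ∈ weightedForms σ k 1 d,
      ((Ideal.Quotient.mkₐ k K).toLinearMap ∘ₗ LinearMap.mulLeft k L) F = 0 ↔ F ∈ K := fun F _ =>
    Ideal.Quotient.eq_zero_iff_mem.trans ⟨hdvd F, K.mul_mem_left L⟩
  rw [hilbertFunction_eq_finrank_map hT, hilbertFunction]
  refine Submodule.finrank_mono ?_
  rintro _ ⟨F, hF, rfl⟩
  exact ⟨L * F, IsWeightedHomogeneous.mul hL hF, rfl⟩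

end HilbertFunction

section Twist

variable {σ R : Type*}

/-- The quotients of an exponent by `m`. -/
def divExp (m : ℕ) (α : σ →₀ ℕ) : σ →₀ ℕ := α.mapRange (· / m) (Nat.zero_div m)

/-- The remainders of an exponent modulo `m`. -/
def modExp (m : ℕ) (α : σ →₀ ℕ) : σ →₀ ℕ := α.mapRange (· % m) (Nat.zero_mod m)

lemma smul_divExp_add_modExp (m : ℕ) (α : σ →₀ ℕ) : m • divExp m α + modExp m α = α := by
  ext i
  simp [divExp, modExp, Nat.div_add_mod]

lemma divExp_smul_add {m : ℕ} (hm : 0 < m) (γ α : σ →₀ ℕ) :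
    divExp m (m • γ + α) = γ + divExp m α := by
  ext i
  simp [divExp, Nat.mul_add_div hm]

lemma modExp_smul_add (m : ℕ) (γ α : σ →₀ ℕ) : modExp m (m • γ + α) = modExp m α := by
  ext i
  simp [modExp]

variable [CommRing R] {m : ℕ} {g : σ → MvPolynomial σ R}

/-- The product `g ^ (α / m) * z ^ (α % m)`, which replaces the monomial `z ^ α`. -/
def twist (m : ℕ) (g : σ → MvPolynomial σ R) (α : σ →₀ ℕ) : MvPolynomial σ R :=
  aeval g (monomial (divExp m α) (1 : R)) * monomial (modExp m α) 1

lemma twist_X_pow (m : ℕ) (α : σ →₀ ℕ) :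
    twist m (fun i => (X i : MvPolynomial σ R) ^ m) α = monomial α 1 := by
  have hpow : aeval (fun i => (X i : MvPolynomial σ R) ^ m) (monomial (divExp m α) (1 : R)) =
      monomial (m • divExp m α) 1 := by
    rw [aeval_monomial, map_one, one_mul, Finsupp.prod, ← one_pow (M := R) m, ← monomial_pow,
      ← prod_X_pow_eq_monomial, ← Finset.prod_pow]
    simp only [pow_right_comm]
  rw [twist, hpow, monomial_mul, smul_divExp_add_modExp, one_mul]

lemma map_twist {R' : Type*} [CommRing R'] (φ : R →+* R') (g : σ → MvPolynomial σ R)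
    (α : σ →₀ ℕ) : map φ (twist m g α) = twist m (fun i => map φ (g i)) α := by
  simp only [twist, aeval_monomial, Finsupp.prod, map_mul, map_prod, map_pow, map_monomial, map_one]

lemma twist_isHomogeneous (hg : ∀ i, (g i).IsHomogeneous m) (α : σ →₀ ℕ) :
    (twist m g α).IsHomogeneous α.degree := by
  have h := ((isHomogeneous_monomial (1 : R) (rfl : (divExp m α).degree = _)).aeval g hg).mul
    (isHomogeneous_monomial (1 : R) (rfl : (modExp m α).degree = _))
  rwa [← smul_eq_mul (a := m), ← map_nsmul, ← map_add, smul_divExp_add_modExp] at h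

lemma aeval_monomial_mul_twist (hm : 0 < m) (γ α : σ →₀ ℕ) (c : R) :
    aeval g (monomial γ c) * twist m g α = c • twist m g (m • γ + α) := by
  rw [twist, twist, divExp_smul_add hm, modExp_smul_add, ← mul_assoc, ← map_mul, monomial_mul,
    mul_one, ← smul_mul_assoc, ← map_smul, smul_monomial, smul_eq_mul, mul_one]

/-- The linear map that sends `z ^ α` to `g ^ (α / m) * z ^ (α % m)`. -/
def twistMap (m : ℕ) (g : σ → MvPolynomial σ R) : MvPolynomial σ R →ₗ[R] MvPolynomial σ R :=
  (basisMonomials σ R).constr R (twist m g)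

lemma twistMap_monomial (α : σ →₀ ℕ) (c : R) :
    twistMap m g (monomial α c) = c • twist m g α := by
  rw [← mul_one c, ← smul_eq_mul, ← smul_monomial, map_smul, twistMap, smul_eq_mul, mul_one]
  exact congrArg (c • ·) ((basisMonomials σ R).constr_basis R (twist m g) α)

lemma homogeneousComponent_twistMap (hg : ∀ i, (g i).IsHomogeneous m) (d : ℕ)
    (F : MvPolynomial σ R) :
    homogeneousComponent d (twistMap m g F) = twistMap m g (homogeneousComponent d F) := by
  suffices homogeneousComponent d ∘ₗ twistMap m g = twistMap m g ∘ₗ homogeneousComponent d from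
    LinearMap.congr_fun this F
  refine (basisMonomials σ R).ext fun α => ?_
  rw [coe_basisMonomials, LinearMap.comp_apply, LinearMap.comp_apply, twistMap_monomial, one_smul,
    homogeneousComponent_of_mem (twist_isHomogeneous hg α),
    homogeneousComponent_of_mem (isHomogeneous_monomial 1 rfl)]
  split_ifs
  · rw [twistMap_monomial, one_smul]
  · rw [map_zero]

lemma aeval_mul_mem_range_twistMap (hm : 0 < m) (F : MvPolynomial σ R) {G : MvPolynomial σ R}
    (hG : G ∈ (twistMap m g).range) : aeval g F * G ∈ (twistMap m g).range := by
  obtain ⟨H, rfl⟩ := hG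
  rw [F.as_sum, H.as_sum, map_sum, map_sum, Finset.sum_mul_sum]
  refine sum_mem fun γ _ => sum_mem fun α _ => ?_
  rw [twistMap_monomial, mul_smul_comm, aeval_monomial_mul_twist hm]
  refine Submodule.smul_mem _ _ (Submodule.smul_mem _ _ ⟨monomial (m • γ + α) 1, ?_⟩)
  rw [twistMap_monomial, one_smul]

lemma degree_modExp_add_single_le [Fintype σ] (hm : 0 < m) (α : σ →₀ ℕ) (i : σ) :
    (modExp m α + Finsupp.single i 1).degree ≤ Fintype.card σ * m := by
  classical
  rw [Finsupp.degree_eq_sum]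
  refine Finset.sum_le_card_nsmul _ _ _ fun j _ => ?_
  have hlt : modExp m α j < m := Nat.mod_lt _ hm
  rw [Finsupp.add_apply, Finsupp.single_apply]
  split_ifs <;> lia

lemma twistMap_surjective [Fintype σ] (hm : 0 < m)
    (h : ∀ α : σ →₀ ℕ, α.degree ≤ Fintype.card σ * m → monomial α 1 ∈ (twistMap m g).range) :
    Function.Surjective (twistMap m g) := by
  rw [← LinearMap.range_eq_top, eq_top_iff]
  rintro F -
  induction F using MvPolynomial.induction_on with
  | C c =>
    have := Submodule.smul_mem _ c (h 0 (by simp))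
    rwa [smul_monomial, smul_eq_mul, mul_one] at this
  | add F G hF hG => exact add_mem hF hG
  | mul_X F i hF =>
    obtain ⟨H, rfl⟩ := hF
    rw [H.as_sum, map_sum, Finset.sum_mul]
    refine sum_mem fun α _ => ?_
    rw [twistMap_monomial, smul_mul_assoc, twist, mul_assoc]
    refine Submodule.smul_mem _ _ (aeval_mul_mem_range_twistMap hm _ ?_)
    rw [X, monomial_mul, mul_one]
    exact h _ (degree_modExp_add_single_le hm α i)

lemma twistMap_injective [Finite σ] (hg : ∀ i, (g i).IsHomogeneous m)
    (h : Function.Surjective (twistMap m g)) : Function.Injective (twistMap m g) := by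
  have hpres (d : ℕ) : ∀ F ∈ homogeneousSubmodule σ R d,
      twistMap m g F ∈ homogeneousSubmodule σ R d := fun F hF => by
    rw [← homogeneousComponent_eq_self hF, ← homogeneousComponent_twistMap hg]
    exact homogeneousComponent_isHomogeneous d _
  have hinj (d : ℕ) : Function.Injective ((twistMap m g).restrict (hpres d)) := by
    have : Module.Finite R (homogeneousSubmodule σ R d) :=
      Module.Finite.iff_fg.2 (homogeneousSubmodule_fg σ R d)
    refine OrzechProperty.injective_of_surjective_endomorphism _ fun F => ?_
    obtain ⟨G, hG⟩ := h F
    refine ⟨⟨homogeneousComponent d G, homogeneousComponent_isHomogeneous d G⟩, Subtype.ext ?_⟩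
    rw [LinearMap.coe_restrict_apply, ← homogeneousComponent_twistMap hg, hG]
    exact homogeneousComponent_eq_self F.2
  refine (injective_iff_map_eq_zero _).2 fun F hF => ?_
  rw [← sum_homogeneousComponent F]
  refine Finset.sum_eq_zero fun d _ => ?_
  have hd : twistMap m g (homogeneousComponent d F) = 0 := by
    rw [← homogeneousComponent_twistMap hg, hF, map_zero]
  exact congrArg Subtype.val (@hinj d ⟨_, homogeneousComponent_isHomogeneous d F⟩ 0
    (Subtype.ext (by simpa using hd)))

end Twist

section Generic

variable {σ R : Type*} [CommRing R]

/-- The exponents of degree at most `N`. -/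
def expsLE (σ : Type*) [Finite σ] (N : ℕ) : Finset (σ →₀ ℕ) :=
  (Finsupp.finite_of_degree_le N).toFinset

lemma mem_expsLE [Finite σ] {N : ℕ} {α : σ →₀ ℕ} : α ∈ expsLE σ N ↔ α.degree ≤ N := by
  simp [expsLE]

/-- A family of polynomials of degree `N` with indeterminate coefficients. -/
def genericPoly [Finite σ] (R : Type*) [CommRing R] (N : ℕ) (i : σ) :
    MvPolynomial σ (MvPolynomial (σ × (σ →₀ ℕ)) R) :=
  ∑ γ ∈ expsLE σ N, monomial γ (X (i, γ))

lemma map_eval_genericPoly [Finite σ] {N : ℕ} {g : σ → MvPolynomial σ R} {i : σ}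
    (hg : (g i).IsHomogeneous N) :
    map (eval fun q : σ × (σ →₀ ℕ) => coeff q.2 (g q.1)) (genericPoly R N i) = g i := by
  classical
  simp only [genericPoly, map_sum, map_monomial, eval_X]
  conv_rhs => rw [(g i).as_sum]
  refine (Finset.sum_subset (fun α hα => ?_) fun α _ hα => ?_).symm
  · refine mem_expsLE.2 (of_not_not fun h => mem_support_iff.1 hα (hg.coeff_eq_zero fun h' => ?_))
    exact h h'.le
  · rw [notMem_support_iff.1 hα, monomial_zero]

variable [Fintype σ] {m : ℕ} {g : σ → MvPolynomial σ R}

/-- The coefficients of the polynomials `twist m g α` in all degrees up to `card σ * m`. These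
degrees suffice to detect whether `twistMap m g` is surjective. -/
def twistMatrix (m : ℕ) (g : σ → MvPolynomial σ R) :
    Matrix (expsLE σ (Fintype.card σ * m)) (expsLE σ (Fintype.card σ * m)) R :=
  Matrix.of fun α β => coeff β.1 (twist m g α.1)

lemma twistMatrix_X_pow [DecidableEq σ] (m : ℕ) :
    twistMatrix m (fun i : σ => (X i : MvPolynomial σ R) ^ m) = 1 := by
  ext α β
  rw [twistMatrix, Matrix.of_apply, twist_X_pow, coeff_monomial, Matrix.one_apply]
  simp only [Subtype.ext_iff]

variable [DecidableEq σ]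

lemma eval_det_twistMatrix_genericPoly (hg : ∀ i, (g i).IsHomogeneous m) :
    eval (fun q : σ × (σ →₀ ℕ) => coeff q.2 (g q.1)) (twistMatrix m (genericPoly R m)).det =
      (twistMatrix m g).det := by
  rw [RingHom.map_det]
  congr 1
  ext α β
  rw [RingHom.mapMatrix_apply, Matrix.map_apply, twistMatrix, twistMatrix, Matrix.of_apply,
    Matrix.of_apply, ← coeff_map, map_twist]
  simp only [map_eval_genericPoly (hg _)]

lemma monomial_mem_range_twistMap (hg : ∀ i, (g i).IsHomogeneous m)
    (hdet : IsUnit (twistMatrix m g).det) {β : σ →₀ ℕ} (hβ : β.degree ≤ Fintype.card σ * m) :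
    monomial β 1 ∈ (twistMap m g).range := by
  let b : expsLE σ (Fintype.card σ * m) := ⟨β, mem_expsLE.2 hβ⟩
  have hexp : (monomial β 1 : MvPolynomial σ R) =
      ∑ α, (twistMatrix m g)⁻¹ b α • twist m g α.1 := by
    ext γ
    rw [coeff_sum]
    simp only [coeff_smul, smul_eq_mul]
    by_cases hγ : γ ∈ expsLE σ (Fintype.card σ * m)
    · refine Eq.trans ?_ (congrFun₂ (Matrix.nonsing_inv_mul _ hdet) b ⟨γ, hγ⟩).symm
      rw [coeff_monomial, Matrix.one_apply]
      simp only [b, Subtype.mk.injEq]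
    · rw [mem_expsLE] at hγ
      rw [coeff_monomial, if_neg (by rintro rfl; exact hγ hβ)]
      refine (Finset.sum_eq_zero fun α _ => ?_).symm
      rw [(twist_isHomogeneous hg α.1).coeff_eq_zero, mul_zero]
      exact fun h => hγ (h ▸ mem_expsLE.1 α.2)
  rw [hexp]
  refine sum_mem fun α _ => Submodule.smul_mem _ _ ⟨monomial α.1 1, ?_⟩
  rw [twistMap_monomial, one_smul]

lemma bijective_twistMap [NeZero m] (hg : ∀ i, (g i).IsHomogeneous m)
    (hdet : IsUnit (twistMatrix m g).det) : Function.Bijective (twistMap m g) :=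
  have hsurj := twistMap_surjective (NeZero.pos m) fun _ => monomial_mem_range_twistMap hg hdet
  ⟨twistMap_injective hg hsurj, hsurj⟩

end Generic

section Assemble

variable {σ R : Type*} [CommRing R] [Fintype σ] {m : ℕ}

/-- The exponent of a monomial in which every variable occurs to a power less than `m`. -/
def smallExp (e : σ → Fin m) : σ →₀ ℕ := Finsupp.equivFunOnFinite.symm fun i => (e i : ℕ)

lemma divExp_smallExp (e : σ → Fin m) : divExp m (smallExp e) = 0 := by
  ext i
  simp [divExp, smallExp]

lemma modExp_smallExp (e : σ → Fin m) : modExp m (smallExp e) = smallExp e := by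
  ext i
  simp [modExp, smallExp, Nat.mod_eq_of_lt]

/-- Division with remainder of exponents by `m`. -/
def expEquiv (σ : Type*) [Fintype σ] (m : ℕ) [NeZero m] :
    (Σ _ : σ → Fin m, σ →₀ ℕ) ≃ (σ →₀ ℕ) where
  toFun p := m • p.2 + smallExp p.1
  invFun α := ⟨fun i => Fin.ofNat m (α i), divExp m α⟩
  left_inv := by
    rintro ⟨e, γ⟩
    simp only [divExp_smul_add (NeZero.pos m), divExp_smallExp, add_zero]
    congr 1
    ext i
    simp [smallExp, Nat.mod_eq_of_lt]
  right_inv α := by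
    ext i
    simp [divExp, smallExp, Nat.div_add_mod]

variable [DecidableEq σ]

/-- The linear map `(F_e) ↦ ∑ F_e(g) z ^ e`, where `e` runs through the exponents smaller than `m`.
It is bijective if and only if the monomials `z ^ e` are a basis of the polynomial ring over itself,
via the substitution of `g`. -/
def assemble (m : ℕ) (g : σ → MvPolynomial σ R) :
    ((σ → Fin m) → MvPolynomial σ R) →ₗ[R] MvPolynomial σ R :=
  ∑ e : σ → Fin m, LinearMap.mulRight R (monomial (smallExp e) (1 : R)) ∘ₗ
    (aeval g).toLinearMap ∘ₗ LinearMap.proj e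

variable {g : σ → MvPolynomial σ R}

lemma assemble_apply (F : (σ → Fin m) → MvPolynomial σ R) :
    assemble m g F = ∑ e, aeval g (F e) * monomial (smallExp e) 1 := by
  simp [assemble]

lemma assemble_single (e : σ → Fin m) (F : MvPolynomial σ R) :
    assemble m g (Pi.single e F) = aeval g F * monomial (smallExp e) 1 := by
  rw [assemble_apply, Finset.sum_eq_single_of_mem e (Finset.mem_univ e) fun e' _ h => by
    rw [Pi.single_eq_of_ne h, map_zero, zero_mul], Pi.single_eq_same]

lemma assemble_eq_twistMap_comp [NeZero m] :
    assemble m g = twistMap m g ∘ₗ ((Pi.basis fun _ => basisMonomials σ R).equiv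
      (basisMonomials σ R) (expEquiv σ m)).toLinearMap := by
  refine (Pi.basis fun _ => basisMonomials σ R).ext fun ⟨e, γ⟩ => ?_
  rw [LinearMap.comp_apply, LinearEquiv.coe_coe, Module.Basis.equiv_apply, Pi.basis_apply,
    assemble_single, coe_basisMonomials, twistMap_monomial, one_smul, twist]
  change _ = aeval g (monomial (divExp m (m • γ + smallExp e)) 1) *
    monomial (modExp m (m • γ + smallExp e)) 1
  rw [divExp_smul_add (NeZero.pos m), modExp_smul_add, divExp_smallExp, modExp_smallExp, add_zero]

lemma bijective_assemble [NeZero m] (hg : ∀ i, (g i).IsHomogeneous m)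
    (hdet : IsUnit (twistMatrix m g).det) : Function.Bijective (assemble m g) := by
  rw [assemble_eq_twistMap_comp]
  exact (bijective_twistMap hg hdet).comp (LinearEquiv.bijective _)

end Assemble

lemma forGeneral_bijective_assemble (m : ℕ) [NeZero m] :
    ForGeneral m fun g => Function.Bijective (assemble m g) := by
  refine ⟨(twistMatrix m (genericPoly ℂ m)).det, ⟨fun i => X i ^ m, ?_, ?_⟩, fun g hg hdet => ?_⟩
  · exact fun i => isHomogeneous_X_pow i m
  · rw [eval_det_twistMatrix_genericPoly fun i => isHomogeneous_X_pow i m, twistMatrix_X_pow,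
      Matrix.det_one]
    exact one_ne_zero
  · rw [eval_det_twistMatrix_genericPoly hg] at hdet
    exact bijective_assemble hg hdet.isUnit

section Pullback

variable {σ R k : Type*} [CommRing R] [Field k] [Fintype σ] [DecidableEq σ] {m : ℕ}

lemma aeval_mul_assemble {g : σ → MvPolynomial σ R} (A : MvPolynomial σ R)
    (F : (σ → Fin m) → MvPolynomial σ R) :
    aeval g A * assemble m g F = assemble m g fun e => A * F e := by
  simp only [assemble_apply, Finset.mul_sum, map_mul, mul_assoc]

lemma assemble_mem_map_aeval_iff {g : σ → MvPolynomial σ R}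
    (hb : Function.Bijective (assemble m g)) (I : Ideal (MvPolynomial σ R))
    {F : (σ → Fin m) → MvPolynomial σ R} :
    assemble m g F ∈ I.map (aeval g) ↔ ∀ e, F e ∈ I := by
  refine ⟨fun h => ?_, fun h => ?_⟩
  · suffices hI : ∀ G ∈ I.map (aeval g), ∃ A, (∀ e, A e ∈ I) ∧ assemble m g A = G by
      obtain ⟨A, hA, hAF⟩ := hI _ h
      exact hb.1 hAF ▸ hA
    intro G hG
    induction hG using Submodule.closure_induction with
    | zero => exact ⟨0, fun _ => zero_mem I, map_zero _⟩
    | add x y _ _ hx hy =>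
      obtain ⟨A, hA, rfl⟩ := hx
      obtain ⟨B, hB, rfl⟩ := hy
      exact ⟨A + B, fun e => add_mem (hA e) (hB e), map_add _ _ _⟩
    | smul_mem c x hx =>
      obtain ⟨f, hf, rfl⟩ := hx
      obtain ⟨A, rfl⟩ := hb.2 c
      exact ⟨fun e => f * A e, fun e => I.mul_mem_right _ hf, by
        rw [← aeval_mul_assemble, smul_eq_mul, mul_comm]⟩
  · rw [assemble_apply]
    exact sum_mem fun e _ => Ideal.mul_mem_right _ _ (Ideal.mem_map_of_mem _ (h e))

lemma weightedPart_assemble {g : σ → MvPolynomial σ R} (hg : ∀ i, (g i).IsHomogeneous m) (d : ℤ)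
    (F : (σ → Fin m) → MvPolynomial σ R) :
    weightedPart 1 d (assemble m g F) =
      assemble m g fun e => weightedPart m (d - (smallExp e).degree) (F e) := by
  rw [assemble_apply, assemble_apply, map_sum]
  refine Finset.sum_congr rfl fun e _ => ?_
  rw [mul_comm, weightedHomogeneousComponent_mul_of_mem (monomial_mem_weightedForms_one _ 1),
    weightedHomogeneousComponent_aeval fun i => mem_weightedForms_one_natCast.2 (hg i), mul_comm]

lemma assemble_mem_weightedForms_iff {g : σ → MvPolynomial σ R} (hg : ∀ i, (g i).IsHomogeneous m)
    (hb : Function.Bijective (assemble m g)) {d : ℤ} {F : (σ → Fin m) → MvPolynomial σ R} :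
    assemble m g F ∈ weightedForms σ R 1 d ↔
      ∀ e, F e ∈ weightedForms σ R m (d - (smallExp e).degree) := by
  rw [mem_weightedForms_iff_weightedPart_eq, weightedPart_assemble hg, hb.1.eq_iff, funext_iff]
  simp only [mem_weightedForms_iff_weightedPart_eq]

lemma mem_of_aeval_mul_mem_map_aeval {g : σ → MvPolynomial σ R}
    (hb : Function.Bijective (assemble m g)) {I : Ideal (MvPolynomial σ R)} {L : MvPolynomial σ R}
    (hL : ∀ F, L * F ∈ I → F ∈ I) {F : MvPolynomial σ R}
    (hF : aeval g L * F ∈ I.map (aeval g)) : F ∈ I.map (aeval g) := by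
  obtain ⟨A, rfl⟩ := hb.2 F
  rw [aeval_mul_assemble, assemble_mem_map_aeval_iff hb] at hF
  exact (assemble_mem_map_aeval_iff hb I).2 fun e => hL _ (hF e)

lemma hilbertFunction_map_aeval [NeZero m] {g : σ → MvPolynomial σ k}
    (hg : ∀ i, (g i).IsHomogeneous m) (hb : Function.Bijective (assemble m g))
    (I : Ideal (MvPolynomial σ k)) (d : ℤ) :
    hilbertFunction (I.map (aeval g)) d = ∑ e : σ → Fin m,
      if (m : ℤ) ∣ d - (smallExp e).degree
        then hilbertFunction I ((d - (smallExp e).degree) / m) else 0 := by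
  have hm : (m : ℤ) ≠ 0 := Nat.cast_ne_zero.2 (NeZero.ne m)
  have := finite_weightedForms (σ := σ) (R := k) hm
  have hforms : weightedForms σ k 1 d = (Submodule.pi Set.univ fun e : σ → Fin m =>
      weightedForms σ k m (d - (smallExp e).degree)).map (assemble m g) := by
    ext F
    obtain ⟨A, rfl⟩ := hb.2 F
    exact (assemble_mem_weightedForms_iff hg hb).trans
      (Set.mem_univ_pi.symm.trans hb.1.mem_set_image.symm)
  rw [hilbertFunction, hforms, ← Submodule.map_comp,
    finrank_map_congr (T' := (Ideal.Quotient.mkₐ k I).toLinearMap.compLeft _) fun F _ => ?_,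
    map_compLeft_pi, finrank_submodule_pi]
  · refine Finset.sum_congr rfl fun e _ => ?_
    split_ifs with h
    · obtain ⟨q, hq⟩ := h
      rw [hq, weightedForms_mul hm, Int.mul_ediv_cancel_left _ hm, hilbertFunction]
    · rw [weightedForms_of_not_dvd h, Submodule.map_bot, finrank_bot]
  · refine Ideal.Quotient.eq_zero_iff_mem.trans ((assemble_mem_map_aeval_iff hb I).trans ?_)
    exact (forall_congr' fun e => Ideal.Quotient.eq_zero_iff_mem.symm).trans
      _root_.funext_iff.symm

end Pullback

section ProjectiveZeros

attribute [local instance] MvPolynomial.gradedAlgebra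

variable {σ R k : Type*} [CommRing R] [Field k]

lemma eval_smul_of_mem_weightedForms_one {d : ℤ} {F : MvPolynomial σ k}
    (hF : F ∈ weightedForms σ k 1 d) (c : kˣ) (v : σ → k) :
    eval (c • v) F = (c : k) ^ d * eval v F := by
  rw [eval_eq, eval_eq, Finset.mul_sum]
  refine Finset.sum_congr rfl fun α hα => ?_
  have hd := mem_weightedForms.1 hF α (mem_support_iff.1 hα)
  rw [← hd, mul_one, zpow_natCast, Finsupp.degree_apply]
  simp only [Pi.smul_apply, Units.smul_def, smul_eq_mul, mul_pow, Finset.prod_mul_distrib,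
    Finset.prod_pow_eq_pow_sum]
  ring

lemma eval_smul_eq_zero {K : Ideal (MvPolynomial σ k)}
    (hK : K.IsHomogeneous (homogeneousSubmodule σ k)) {v : σ → k}
    (hv : ∀ F ∈ K, eval v F = 0) (c : kˣ) {F : MvPolynomial σ k} (hF : F ∈ K) :
    eval (c • v) F = 0 := by
  rw [← sum_homogeneousComponent F, map_sum]
  refine Finset.sum_eq_zero fun d _ => ?_
  rw [eval_smul_of_mem_weightedForms_one
    (mem_weightedForms_one_natCast.2 (homogeneousComponent_isHomogeneous d F)),
    hv _ (homogeneousComponent_mem_of_mem hK hF d), mul_zero]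

lemma exists_idealOfVars_pow_le [Finite σ] [IsAlgClosed k] {K : Ideal (MvPolynomial σ k)}
    (h : ∀ v : σ → k, v ≠ 0 → ∃ F ∈ K, eval v F ≠ 0) : ∃ N : ℕ, idealOfVars σ k ^ N ≤ K := by
  refine Ideal.exists_pow_le_of_le_radical_of_fg ?_ (idealOfVars_fg σ k)
  rw [← vanishingIdeal_zeroLocus_eq_radical (K := k), idealOfVars, Ideal.span_le]
  rintro _ ⟨i, rfl⟩
  rw [SetLike.mem_coe, mem_vanishingIdeal_iff]
  intro v hv
  have hv0 : v = 0 := by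
    by_contra hv0
    obtain ⟨F, hF, hne⟩ := h v hv0
    exact hne (by simpa [aeval_eq_eval] using mem_zeroLocus_iff.1 hv F hF)
  rw [aeval_X, hv0, Pi.zero_apply]

lemma mem_idealOfVars_pow {d : ℤ} {F : MvPolynomial σ R} (hF : F ∈ weightedForms σ R 1 d) {N : ℕ}
    (h : (N : ℤ) ≤ d) : F ∈ idealOfVars σ R ^ N := by
  rw [mem_pow_idealOfVars_iff]
  intro α hα
  have := mem_weightedForms.1 hF α (mem_support_iff.1 hα)
  lia

lemma mem_of_forall_idealOfVars_pow_mul_mem {J : Ideal (MvPolynomial σ R)}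
    (hJ : ∀ F, (∀ i, X i * F ∈ J) → F ∈ J) {F : MvPolynomial σ R} {N : ℕ}
    (h : ∀ G ∈ idealOfVars σ R ^ N, G * F ∈ J) : F ∈ J := by
  induction N with
  | zero => simpa using h 1 (by simp)
  | succ N ih =>
    refine ih fun G hG => hJ _ fun i => ?_
    rw [← mul_assoc]
    refine h _ ?_
    rw [pow_succ']
    exact Ideal.mul_mem_mul (Ideal.subset_span ⟨i, rfl⟩) hG

lemma mem_of_mul_mem_of_idealOfVars_pow_le {J : Ideal (MvPolynomial σ R)}
    (hJ : ∀ F, (∀ i, X i * F ∈ J) → F ∈ J) {H : MvPolynomial σ R} {N : ℕ}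
    (hN : idealOfVars σ R ^ N ≤ J ⊔ Ideal.span {H}) {F : MvPolynomial σ R} (h : H * F ∈ J) :
    F ∈ J := by
  refine mem_of_forall_idealOfVars_pow_mul_mem hJ (N := N) fun G hG => ?_
  obtain ⟨j, hj, y, hy, rfl⟩ := Submodule.mem_sup.1 (hN hG)
  obtain ⟨A, rfl⟩ := Ideal.mem_span_singleton'.1 hy
  rw [add_mul, mul_assoc]
  exact add_mem (J.mul_mem_right _ hj) (J.mul_mem_left _ h)

lemma exists_sub_mul_mem_of_idealOfVars_pow_le {K : Ideal (MvPolynomial σ R)}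
    (hK : K.IsHomogeneous (homogeneousSubmodule σ R)) {H : MvPolynomial σ R} {e : ℤ}
    (he : H ∈ weightedForms σ R 1 e) {N : ℕ} (hN : idealOfVars σ R ^ N ≤ K ⊔ Ideal.span {H})
    {d : ℤ} (hd : N ≤ e + d) {F : MvPolynomial σ R} (hF : F ∈ weightedForms σ R 1 (e + d)) :
    ∃ G ∈ weightedForms σ R 1 d, F - H * G ∈ K := by
  obtain ⟨A, hA, y, hy, hsum⟩ := Submodule.mem_sup.1 (hN (mem_idealOfVars_pow hF hd))
  obtain ⟨G, rfl⟩ := Ideal.mem_span_singleton'.1 hy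
  refine ⟨weightedPart 1 d G, weightedHomogeneousComponent_isWeightedHomogeneous d G, ?_⟩
  have hmul := weightedHomogeneousComponent_mul_of_mem he (e + d) G
  rw [add_sub_cancel_left] at hmul
  rw [← mem_weightedForms_iff_weightedPart_eq.1 hF, ← hmul, ← map_sub, ← hsum, mul_comm H G,
    add_sub_cancel_right]
  exact weightedPart_mem hK hA _ _

end ProjectiveZeros

section Points

attribute [local instance] MvPolynomial.gradedAlgebra

variable {K J : Ideal S}

lemma mk_mem_points (hK : K.IsHomogeneous (homogeneousSubmodule (Fin 3) ℂ)) {v : Fin 3 → ℂ}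
    (hv0 : v ≠ 0) (hv : ∀ F ∈ K, eval v F = 0) : Projectivization.mk ℂ v hv0 ∈ points K := by
  intro F hF
  obtain ⟨c, hc⟩ := Projectivization.exists_smul_eq_mk_rep ℂ v hv0
  rw [← hc]
  exact eval_smul_eq_zero hK hv c hF

lemma eval_ne_zero_of_mem_nonvanishing
    (hK : K.IsHomogeneous (homogeneousSubmodule (Fin 3) ℂ)) {v : Fin 3 → ℂ} (hv0 : v ≠ 0)
    (hv : ∀ F ∈ K, eval v F = 0) {H : S} (hH : H ∈ nonvanishing K) : eval v H ≠ 0 := by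
  obtain ⟨⟨e, he⟩, hne⟩ := hH
  obtain ⟨c, hc⟩ := Projectivization.exists_smul_eq_mk_rep ℂ v hv0
  have := hne _ (mk_mem_points hK hv0 hv)
  rw [← hc, eval_smul_of_mem_weightedForms_one he] at this
  exact right_ne_zero_of_mul this

lemma exists_idealOfVars_pow_le_sup_span
    (hK : K.IsHomogeneous (homogeneousSubmodule (Fin 3) ℂ)) {H : S} (hH : H ∈ nonvanishing K) :
    ∃ N : ℕ, idealOfVars (Fin 3) ℂ ^ N ≤ K ⊔ Ideal.span {H} := by
  refine exists_idealOfVars_pow_le fun v hv0 => ?_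
  by_contra! hcon
  exact eval_ne_zero_of_mem_nonvanishing hK hv0 (fun F hF => hcon F (Ideal.mem_sup_left hF)) hH
    (hcon H (Ideal.mem_sup_right (Ideal.mem_span_singleton_self H)))

lemma IsIdealOfZeroDimScheme.isHomogeneous (hJ : IsIdealOfZeroDimScheme J) :
    J.IsHomogeneous (homogeneousSubmodule (Fin 3) ℂ) := by
  intro d F hF
  change (decomposition.decompose' F d : S) ∈ J
  rw [decomposition.decompose'_apply]
  exact hJ.homogeneous F hF d

lemma IsIdealOfZeroDimScheme.mem_of_mul_mem (hJ : IsIdealOfZeroDimScheme J) {H : S}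
    (hH : H ∈ nonvanishing J) {F : S} (h : H * F ∈ J) : F ∈ J :=
  have ⟨_, hN⟩ := exists_idealOfVars_pow_le_sup_span hJ.isHomogeneous hH
  mem_of_mul_mem_of_idealOfVars_pow_le hJ.saturated hN h

lemma IsIdealOfZeroDimScheme.exists_linear_mem_nonvanishing (hJ : IsIdealOfZeroDimScheme J) :
    ∃ L ∈ forms 1, L ∈ nonvanishing J := by
  have := hJ.finite.to_subtype
  obtain ⟨φ, hφ⟩ := Module.exists_dual_forall_apply_ne_zero (K := ℂ)
    (fun p : points J => p.1.rep) fun p => p.1.rep_nonzero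
  have hmem : (∑ i, φ (fun j => if i = j then 1 else 0) • X i : S) ∈ forms 1 :=
    sum_mem fun i _ => Submodule.smul_mem _ _ (isWeightedHomogeneous_X ℂ _ i)
  refine ⟨_, hmem, ⟨1, hmem⟩, fun p hp => ?_⟩
  have h := hφ ⟨p, hp⟩
  rw [LinearMap.pi_apply_eq_sum_univ φ] at h
  simpa only [map_sum, smul_eval, eval_X, smul_eq_mul, mul_comm] using h

end Points

section PullbackZeros

lemma eval_aeval {σ τ R : Type*} [CommSemiring R] (g : σ → MvPolynomial τ R) (v : τ → R)
    (F : MvPolynomial σ R) : eval v (aeval g F) = eval (fun i => eval v (g i)) F := by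
  have hC : (eval v).comp C = RingHom.id R := RingHom.ext fun _ => eval_C _
  rw [map_aeval, algebraMap_eq, hC]
  rfl

variable {σ R : Type*} [CommRing R] [Fintype σ] [DecidableEq σ] {m : ℕ}
  {g : σ → MvPolynomial σ R}

lemma eval_assemble_eq_zero {v : σ → R} (hv : ∀ i, eval v (g i) = 0)
    {F : (σ → Fin m) → MvPolynomial σ R} (hF : ∀ e, constantCoeff (F e) = 0) :
    eval v (assemble m g F) = 0 := by
  have hv' : (fun i => eval v (g i)) = 0 := funext hv
  rw [assemble_apply, map_sum]
  refine Finset.sum_eq_zero fun e _ => ?_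
  rw [map_mul, eval_aeval, hv', eval_zero, hF, zero_mul]

lemma eq_zero_of_forall_eval_eq_zero [IsReduced R] (hg : ∀ i, (g i).IsHomogeneous m)
    (hb : Function.Bijective (assemble m g)) {v : σ → R} (hv : ∀ i, eval v (g i) = 0) : v = 0 := by
  funext i
  set N : ℕ := ∑ e : σ → Fin m, (smallExp e).degree + 1
  obtain ⟨A, hA⟩ := hb.2 (X i ^ N)
  have hmem : assemble m g A ∈ weightedForms σ R 1 N :=
    hA ▸ mem_weightedForms_one_natCast.2 (isHomogeneous_X_pow i N)
  have hconst : ∀ e, constantCoeff (A e) = 0 := fun e => by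
    by_contra hne
    have hdeg := mem_weightedForms.1 ((assemble_mem_weightedForms_iff hg hb).1 hmem e) 0 hne
    have hlt : (smallExp e).degree < N := Nat.lt_succ_of_le
      (Finset.single_le_sum (f := fun e => (smallExp e).degree) (fun _ _ => Nat.zero_le _)
        (Finset.mem_univ e))
    rw [map_zero, Nat.cast_zero, zero_mul] at hdeg
    lia
  have h := eval_assemble_eq_zero hv hconst
  rw [hA, map_pow, eval_X] at h
  exact eq_zero_of_pow_eq_zero h

end PullbackZeros

section PullbackNonvanishing

attribute [local instance] MvPolynomial.gradedAlgebra

lemma aeval_mem_weightedForms_one {σ τ R : Type*} [CommSemiring R] {m : ℕ}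
    {g : σ → MvPolynomial τ R} (hg : ∀ i, (g i).IsHomogeneous m) {F : MvPolynomial σ R} {d : ℕ}
    (hF : F ∈ weightedForms σ R 1 d) : aeval g F ∈ weightedForms τ R 1 (m * d : ℕ) :=
  mem_weightedForms_one_natCast.2 ((mem_weightedForms_one_natCast.1 hF).aeval g hg)

lemma aeval_mem_nonvanishing {m : ℕ} {g : Fin 3 → S} {J : Ideal S}
    (hJ : J.IsHomogeneous (homogeneousSubmodule (Fin 3) ℂ)) (hg : ∀ i, (g i).IsHomogeneous m)
    (hb : Function.Bijective (assemble m g)) {d : ℕ} {L : S} (hLd : L ∈ forms d)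
    (hL : L ∈ nonvanishing J) :
    aeval g L ∈ nonvanishing (pullback g J) := by
  refine ⟨⟨_, aeval_mem_weightedForms_one hg hLd⟩, fun p hp => ?_⟩
  rw [eval_aeval]
  refine eval_ne_zero_of_mem_nonvanishing hJ (fun h => p.rep_nonzero ?_) (fun F hF => ?_) hL
  · exact eq_zero_of_forall_eval_eq_zero hg hb (congrFun h)
  · rw [← eval_aeval]
    exact hp _ (Ideal.mem_map_of_mem _ hF)

end PullbackNonvanishing

section Sections

open Filter

attribute [local instance] MvPolynomial.gradedAlgebra

variable {K : Ideal S}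

lemma toLoc_apply (F : S) :
    toLoc K F = algebraMap (S ⧸ K) (LocRing K) (Ideal.Quotient.mk K F) := rfl

lemma isUnit_toLoc {H : S} (hH : H ∈ nonvanishing K) : IsUnit (toLoc K H) :=
  IsLocalization.map_units (LocRing K)
    (⟨Ideal.Quotient.mk K H, H, hH, rfl⟩ : (nonvanishing K).map (Ideal.Quotient.mk K))

lemma toLoc_eq_zero_of_mem {F : S} (hF : F ∈ K) : toLoc K F = 0 := by
  rw [toLoc_apply, Ideal.Quotient.eq_zero_iff_mem.2 hF, map_zero]

lemma toLoc_eq_of_sub_mem {F G : S} (h : F - G ∈ K) : toLoc K F = toLoc K G := by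
  rw [← sub_eq_zero, ← map_sub, toLoc_eq_zero_of_mem h]

lemma exists_mul_mem_of_toLoc_eq_zero {F : S} (hF : toLoc K F = 0) :
    ∃ H ∈ nonvanishing K, H * F ∈ K := by
  rw [toLoc_apply, IsLocalization.map_eq_zero_iff ((nonvanishing K).map (Ideal.Quotient.mk K))]
    at hF
  obtain ⟨⟨_, H, hH, rfl⟩, hHF⟩ := hF
  exact ⟨H, hH, Ideal.Quotient.eq_zero_iff_mem.1 (by rw [map_mul]; exact hHF)⟩

lemma map_toLoc_forms_le_sections (d : ℤ) :
    (forms d).map (toLoc K).toLinearMap ≤ sections K d := by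
  rintro _ ⟨F, hF, rfl⟩
  exact ⟨0, 1, one_mem _, F, by rwa [add_zero], isWeightedHomogeneous_one ℂ _,
    by rw [map_one, one_mul]; rfl⟩

variable {L : S} {m : ℕ}

lemma pow_mem_forms (hL : L ∈ forms m) (N : ℕ) : L ^ N ∈ forms (N * m) := by
  have := IsWeightedHomogeneous.pow hL N
  rwa [nsmul_eq_mul] at this

variable (hK : K.IsHomogeneous (homogeneousSubmodule (Fin 3) ℂ))

include hK

lemma eventually_exists_pow_sub_mul_mem (hm : 0 < m) (hLm : L ∈ forms m) {H : S} {e : ℤ}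
    (hH : H ∈ nonvanishing K) (he : H ∈ forms e) :
    ∀ᶠ N : ℕ in atTop, ∃ G ∈ forms (N * m - e), L ^ N - H * G ∈ K := by
  obtain ⟨N₀, hN₀⟩ := exists_idealOfVars_pow_le_sup_span hK hH
  filter_upwards [eventually_ge_atTop N₀] with N hN
  have hle : N ≤ N * m := Nat.le_mul_of_pos_right N hm
  refine exists_sub_mul_mem_of_idealOfVars_pow_le hK he hN₀ ?_ ?_
  · rw [add_sub_cancel]
    exact_mod_cast hN.trans hle
  · rw [add_sub_cancel]
    exact pow_mem_forms hLm N

lemma exists_forall_exists_sub_pow_mul_mem (hLm : L ∈ forms m) (hL : L ∈ nonvanishing K) :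
    ∃ N : ℕ, ∀ (r : ℕ) (d : ℤ), N ≤ d → ∀ F ∈ forms (r * m + d), ∃ G ∈ forms d,
      F - L ^ r * G ∈ K := by
  obtain ⟨N, hN⟩ := exists_idealOfVars_pow_le_sup_span hK hL
  refine ⟨N, fun r d hd => ?_⟩
  induction r with
  | zero => exact fun F hF => ⟨F, by simpa using hF, by simp⟩
  | succ r ih =>
    intro F hF
    rw [Nat.cast_succ, add_one_mul, add_comm _ (m : ℤ), add_assoc] at hF
    have hle : (N : ℤ) ≤ m + (r * m + d) := by
      have : (0 : ℤ) ≤ m + r * m := by positivity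
      lia
    obtain ⟨G, hG, hFG⟩ := exists_sub_mul_mem_of_idealOfVars_pow_le hK hLm hN hle hF
    obtain ⟨G', hG', hGG'⟩ := ih G hG
    refine ⟨G', hG', ?_⟩
    have hsum : F - L ^ (r + 1) * G' = (F - L * G) + L * (G - L ^ r * G') := by ring
    rw [hsum]
    exact add_mem hFG (K.mul_mem_left _ hGG')

lemma toLoc_eq_zero_iff (hm : 0 < m) (hLm : L ∈ forms m) (hdvd : ∀ F, L * F ∈ K → F ∈ K) {F : S} :
    toLoc K F = 0 ↔ F ∈ K := by
  refine ⟨fun hF => ?_, toLoc_eq_zero_of_mem⟩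
  obtain ⟨H, hH, hHF⟩ := exists_mul_mem_of_toLoc_eq_zero hF
  obtain ⟨e, he⟩ := hH.1
  obtain ⟨N, G, -, hG⟩ := (eventually_exists_pow_sub_mul_mem hK hm hLm hH he).exists
  have hpow : L ^ N * F ∈ K := by
    have hsum : L ^ N * F = (L ^ N - H * G) * F + G * (H * F) := by ring
    rw [hsum]
    exact add_mem (K.mul_mem_right _ hG) (K.mul_mem_left _ hHF)
  clear hG
  induction N with
  | zero => rwa [pow_zero, one_mul] at hpow
  | succ N ih => exact ih (hdvd _ (by rwa [← mul_assoc, ← pow_succ']))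

lemma eventually_map_mulLeft_sections (hm : 0 < m) (hLm : L ∈ forms m) (hL : L ∈ nonvanishing K)
    (d : ℤ) : ∀ᶠ N : ℕ in atTop,
      (sections K d).map (LinearMap.mulLeft ℂ (toLoc K (L ^ N))) =
        (forms (N * m + d)).map (toLoc K).toLinearMap := by
  obtain ⟨N₀, hN₀⟩ := exists_forall_exists_sub_pow_mul_mem hK hLm hL
  filter_upwards [eventually_ge_atTop (N₀ + d.natAbs)] with N hN
  have hNd : (N₀ : ℤ) ≤ N * m + d := by
    have : N ≤ N * m := Nat.le_mul_of_pos_right N hm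
    lia
  ext y
  constructor
  · rintro ⟨x, ⟨e, H, hH, F, hF, he, hx⟩, rfl⟩
    obtain ⟨N₁, hN₁, G, hG, hLG⟩ := ((eventually_ge_atTop N).and
      (eventually_exists_pow_sub_mul_mem hK hm hLm hH he)).exists
    obtain ⟨r, rfl⟩ := Nat.exists_eq_add_of_le' hN₁
    have hGF : G * F ∈ forms (r * m + (N * m + d)) := by
      have hdeg : r * m + (N * m + d) = ((r + N : ℕ) * m - e) + (d + e) := by
        push_cast
        ring
      exact hdeg ▸ IsWeightedHomogeneous.mul hG hF
    obtain ⟨F', hF', hFF'⟩ := hN₀ r _ hNd _ hGF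
    refine ⟨F', hF', (isUnit_toLoc (pow_mem hL r)).mul_left_cancel ?_⟩
    calc toLoc K (L ^ r) * toLoc K F' = toLoc K (G * F) := by
          rw [← map_mul, toLoc_eq_of_sub_mem hFF']
      _ = toLoc K (H * G) * x := by rw [map_mul, map_mul, ← hx]; ring
      _ = toLoc K (L ^ (r + N)) * x := by rw [toLoc_eq_of_sub_mem hLG]
      _ = toLoc K (L ^ r) * (toLoc K (L ^ N) * x) := by rw [pow_add, map_mul, mul_assoc]
  · rintro ⟨F, hF, rfl⟩
    obtain ⟨u, hu⟩ := (isUnit_toLoc (pow_mem hL N)).exists_right_inv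
    have huF : toLoc K (L ^ N) * (u * toLoc K F) = toLoc K F := by rw [← mul_assoc, hu, one_mul]
    exact ⟨u * toLoc K F, ⟨N * m, L ^ N, pow_mem hL N, F, by rwa [add_comm],
      pow_mem_forms hLm N, huF⟩, huF⟩

lemma eventually_defect_add_hilbertFunction (hm : 0 < m) (hLm : L ∈ forms m)
    (hL : L ∈ nonvanishing K) (hdvd : ∀ F, L * F ∈ K → F ∈ K) (d : ℤ) :
    ∀ᶠ N : ℕ in atTop, defect K d + hilbertFunction K d = hilbertFunction K (N * m + d) := by
  filter_upwards [eventually_map_mulLeft_sections hK hm hLm hL d] with N hN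
  have hinj : Function.Injective (LinearMap.mulLeft ℂ (toLoc K (L ^ N))) :=
    (isUnit_toLoc (pow_mem hL N)).mul_right_injective
  have hhilb (c : ℤ) : hilbertFunction K c =
      Module.finrank ℂ ((forms c).map (toLoc K).toLinearMap) :=
    hilbertFunction_eq_finrank_map fun F _ => toLoc_eq_zero_iff hK hm hLm hdvd
  have equiv := Submodule.equivMapOfInjective _ hinj (sections K d)
  rw [hN] at equiv
  have : FiniteDimensional ℂ (forms (N * m + d)) :=
    inferInstanceAs (FiniteDimensional ℂ (weightedForms (Fin 3) ℂ 1 (N * m + d)))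
  have : FiniteDimensional ℂ (sections K d) := equiv.symm.finiteDimensional
  rw [hhilb, hhilb, ← equiv.finrank_eq]
  exact finrank_quotient_submoduleOf_add_finrank (map_toLoc_forms_le_sections d)

end Sections

section Defect

open Filter

variable {J : Ideal S}

lemma IsIdealOfZeroDimScheme.one_notMem (hJ : IsIdealOfZeroDimScheme J) : 1 ∉ J := fun h => by
  obtain ⟨p, hp⟩ := hJ.nonempty
  simpa using hp 1 h

lemma hilbertFunction_zero_pos {σ k : Type*} [Field k] [Finite σ] {K : Ideal (MvPolynomial σ k)}
    (hK : 1 ∉ K) : 0 < hilbertFunction K 0 := by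
  rw [hilbertFunction, Module.finrank_pos_iff, Submodule.nontrivial_iff_ne_bot]
  refine (Submodule.ne_bot_iff _).2 ⟨_, ⟨1, isWeightedHomogeneous_one k _, rfl⟩, ?_⟩
  exact fun h => hK (Ideal.Quotient.eq_zero_iff_mem.1 h)

lemma IsIdealOfZeroDimScheme.exists_defect_add_hilbertFunction (hJ : IsIdealOfZeroDimScheme J) :
    ∃ c, (∀ᶠ d : ℤ in atTop, hilbertFunction J d = c) ∧
      ∀ d, defect J d + hilbertFunction J d = c := by
  obtain ⟨L, hL1, hL⟩ := hJ.exists_linear_mem_nonvanishing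
  have hev (d : ℤ) : ∀ᶠ N : ℕ in atTop,
      defect J d + hilbertFunction J d = hilbertFunction J (N + d) := by
    simpa only [Nat.cast_one, mul_one] using eventually_defect_add_hilbertFunction
      hJ.isHomogeneous one_pos (by rwa [Nat.cast_one]) hL (fun _ => hJ.mem_of_mul_mem hL) d
  have hc : ∀ᶠ z : ℤ in atTop, hilbertFunction J z = defect J 0 + hilbertFunction J 0 := by
    rw [← Nat.map_cast_int_atTop, eventually_map]
    filter_upwards [hev 0] with N hN
    rw [hN, add_zero]
  refine ⟨_, hc, fun d => ?_⟩
  obtain ⟨N, hN, hNc⟩ := ((hev d).and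
    ((tendsto_atTop_add_const_right _ d tendsto_natCast_atTop_atTop).eventually hc)).exists
  exact hN.trans hNc

lemma IsIdealOfZeroDimScheme.antitone_defect (hJ : IsIdealOfZeroDimScheme J) :
    Antitone (defect J) := by
  obtain ⟨L, hL1, hL⟩ := hJ.exists_linear_mem_nonvanishing
  obtain ⟨c, -, hc⟩ := hJ.exists_defect_add_hilbertFunction
  refine antitone_int_of_succ_le fun d => ?_
  have hle := hilbertFunction_le_add hL1 (fun _ => hJ.mem_of_mul_mem hL) d
  rw [add_comm] at hle
  have := hc d
  have := hc (d + 1)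
  lia

lemma IsIdealOfZeroDimScheme.defect_pos_of_neg (hJ : IsIdealOfZeroDimScheme J) {d : ℤ}
    (hd : d < 0) : 0 < defect J d := by
  obtain ⟨c, -, hc⟩ := hJ.exists_defect_add_hilbertFunction
  have := hilbertFunction_zero_pos hJ.one_notMem
  have := hilbertFunction_of_neg J hd
  have := hc 0
  have := hc d
  lia

lemma IsIdealOfZeroDimScheme.defect_pullback (hJ : IsIdealOfZeroDimScheme J) {m : ℕ} [NeZero m]
    {g : Fin 3 → S} (hg : ∀ i, (g i).IsHomogeneous m) (hb : Function.Bijective (assemble m g))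
    (d : ℤ) :
    defect (pullback g J) d = ∑ e : Fin 3 → Fin m,
      if (m : ℤ) ∣ d - (smallExp e).degree
        then defect J ((d - (smallExp e).degree) / m) else 0 := by
  have hm : (m : ℤ) ≠ 0 := Nat.cast_ne_zero.2 (NeZero.ne m)
  obtain ⟨c, hev, hc⟩ := hJ.exists_defect_add_hilbertFunction
  obtain ⟨L, hL1, hL⟩ := hJ.exists_linear_mem_nonvanishing
  have hgL : aeval g L ∈ forms m := by
    have := aeval_mem_weightedForms_one hg (d := 1) hL1
    rwa [mul_one] at this
  have hev' (q : ℤ) : ∀ᶠ N : ℕ in atTop, hilbertFunction J (N + q) = c :=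
    (tendsto_atTop_add_const_right _ q tendsto_natCast_atTop_atTop).eventually hev
  obtain ⟨N, hN, hNc⟩ := ((eventually_defect_add_hilbertFunction
    (isHomogeneous_map_aeval hg hJ.isHomogeneous) (NeZero.pos m) hgL
    (aeval_mem_nonvanishing hJ.isHomogeneous hg hb (d := 1) hL1 hL)
    (fun _ => mem_of_aeval_mul_mem_map_aeval hb fun _ => hJ.mem_of_mul_mem hL) d).and
    (eventually_all.2 fun e : Fin 3 → Fin m => hev' ((d - (smallExp e).degree) / m))).exists
  rw [hilbertFunction_map_aeval hg hb, hilbertFunction_map_aeval hg hb] at hN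
  refine add_right_cancel (hN.trans ?_)
  rw [← Finset.sum_add_distrib]
  refine Finset.sum_congr rfl fun e _ => ?_
  simp only [add_sub_assoc, Int.dvd_add_right (Dvd.intro_left _ rfl)]
  split_ifs
  · rw [Int.add_ediv_of_dvd_left (Dvd.intro_left _ rfl), Int.mul_ediv_cancel _ hm, hNc, hc]
  · rfl

end Defect

section Resolution

open scoped fwdDiff

/-- The piece of degree `d` of the graded free module `⨁ᵢ S(-c i)` over the polynomial ring `S`. -/
def freePiece {σ R ι : Type*} [CommSemiring R] (c : ι → ℤ) (d : ℤ) :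
    Submodule R (ι → MvPolynomial σ R) :=
  Submodule.pi Set.univ fun i => weightedForms σ R 1 (d - c i)

lemma mem_freePiece {σ R ι : Type*} [CommSemiring R] {c : ι → ℤ} {d : ℤ}
    {v : ι → MvPolynomial σ R} :
    v ∈ freePiece c d ↔ ∀ i, v i ∈ weightedForms σ R 1 (d - c i) :=
  Set.mem_univ_pi

instance {σ k ι : Type*} [Finite σ] [Field k] [Finite ι] (c : ι → ℤ) (d : ℤ) :
    FiniteDimensional k (freePiece (σ := σ) (R := k) c d) :=
  inferInstanceAs (FiniteDimensional k
    (Submodule.pi Set.univ fun i => weightedForms σ k 1 (d - c i)))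

section GradedMaps

variable {σ R ι κ : Type*} [CommRing R] [Fintype κ] {a : ι → ℤ} {b : κ → ℤ}
  {f : ι → MvPolynomial σ R} {M : Matrix ι κ (MvPolynomial σ R)}

lemma weightedPart_mulVec (hM : ∀ i j, M i j ∈ weightedForms σ R 1 (b j - a i)) (d : ℤ)
    (w : κ → MvPolynomial σ R) (i : ι) :
    weightedPart 1 (d - a i) (M.mulVec w i) =
      M.mulVec (fun j => weightedPart 1 (d - b j) (w j)) i := by
  simp only [Matrix.mulVec, dotProduct, map_sum]
  refine Finset.sum_congr rfl fun j _ => ?_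
  rw [weightedHomogeneousComponent_mul_of_mem (hM i j), sub_sub_sub_cancel_right]

lemma map_mulVecLin_freePiece (hM : ∀ i j, M i j ∈ weightedForms σ R 1 (b j - a i)) (d : ℤ) :
    (freePiece b d).map (M.mulVecLin.restrictScalars R) =
      (M.mulVecLin.restrictScalars R).range ⊓ freePiece a d := by
  ext v
  constructor
  · rintro ⟨w, hw, rfl⟩
    refine ⟨⟨w, rfl⟩, mem_freePiece.2 fun i => mem_weightedForms_iff_weightedPart_eq.2 ?_⟩
    refine (weightedPart_mulVec hM d w i).trans ?_
    rw [funext fun j => mem_weightedForms_iff_weightedPart_eq.1 (mem_freePiece.1 hw j)]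
    rfl
  · rintro ⟨⟨w, rfl⟩, hw⟩
    refine ⟨fun j => weightedPart 1 (d - b j) (w j), mem_freePiece.2 fun j =>
      weightedHomogeneousComponent_isWeightedHomogeneous _ _, funext fun i => ?_⟩
    exact (weightedPart_mulVec hM d w i).symm.trans
      (mem_weightedForms_iff_weightedPart_eq.1 (mem_freePiece.1 hw i))

variable [Fintype ι]

lemma weightedPart_linearCombination (hf : ∀ i, f i ∈ weightedForms σ R 1 (a i)) (d : ℤ)
    (v : ι → MvPolynomial σ R) :
    weightedPart 1 d (Fintype.linearCombination (MvPolynomial σ R) f v) =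
      Fintype.linearCombination (MvPolynomial σ R) f fun i => weightedPart 1 (d - a i) (v i) := by
  simp only [Fintype.linearCombination_apply, map_sum, smul_eq_mul]
  refine Finset.sum_congr rfl fun i _ => ?_
  rw [mul_comm, weightedHomogeneousComponent_mul_of_mem (hf i), mul_comm]

lemma map_linearCombination_freePiece (hf : ∀ i, f i ∈ weightedForms σ R 1 (a i)) (d : ℤ) :
    (freePiece a d).map ((Fintype.linearCombination (MvPolynomial σ R) f).restrictScalars R) =
      (Ideal.span (Set.range f)).restrictScalars R ⊓ weightedForms σ R 1 d := by
  have hspan : Ideal.span (Set.range f) = (Fintype.linearCombination (MvPolynomial σ R) f).range :=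
    (Fintype.range_linearCombination _ f).symm
  ext F
  rw [hspan]
  constructor
  · rintro ⟨v, hv, rfl⟩
    refine ⟨⟨v, rfl⟩, mem_weightedForms_iff_weightedPart_eq.2 ?_⟩
    refine (weightedPart_linearCombination hf d v).trans ?_
    rw [funext fun i => mem_weightedForms_iff_weightedPart_eq.1 (mem_freePiece.1 hv i)]
    rfl
  · rintro ⟨⟨v, rfl⟩, hv⟩
    refine ⟨fun i => weightedPart 1 (d - a i) (v i), mem_freePiece.2 fun i =>
      weightedHomogeneousComponent_isWeightedHomogeneous _ _, ?_⟩
    exact (weightedPart_linearCombination hf d v).symm.trans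
      (mem_weightedForms_iff_weightedPart_eq.1 hv)

lemma exists_ne_zero_of_exact [Nontrivial R] [Nontrivial ι]
    (hexact : Function.Exact M.mulVecLin (Fintype.linearCombination (MvPolynomial σ R) f))
    (hmin : ∀ i j, constantCoeff (M i j) = 0) (i : ι) : ∃ j, M i j ≠ 0 := by
  classical
  by_contra! hM
  have hker {v : ι → MvPolynomial σ R}
      (hv : Fintype.linearCombination (MvPolynomial σ R) f v = 0) : v i = 0 := by
    obtain ⟨w, rfl⟩ := (hexact v).1 hv
    simp [Matrix.mulVec, dotProduct, hM]
  obtain ⟨l, hl⟩ := exists_ne i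
  have hfl : f l = 0 := by
    -- The Koszul relation between `f i` and `f l` has `i`-th entry `f l`.
    have := hker (v := f l • Pi.single i 1 - f i • Pi.single l 1) (by
      rw [map_sub, map_smul, map_smul, Fintype.linearCombination_apply_single,
        Fintype.linearCombination_apply_single]
      simp [mul_comm])
    simpa [hl.symm] using this
  obtain ⟨w, hw⟩ := (hexact (Pi.single l 1)).1 (by
    rw [Fintype.linearCombination_apply_single, hfl, smul_zero])
  have := congrArg constantCoeff (congrFun hw l)
  simp [Matrix.mulVec, dotProduct, hmin] at this

lemma exists_lt_of_exact [Nontrivial R] [Nontrivial ι]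
    (hM : ∀ i j, M i j ∈ weightedForms σ R 1 (b j - a i))
    (hexact : Function.Exact M.mulVecLin (Fintype.linearCombination (MvPolynomial σ R) f))
    (hmin : ∀ i j, constantCoeff (M i j) = 0) (i : ι) : ∃ j, a i < b j := by
  obtain ⟨j, hj⟩ := exists_ne_zero_of_exact hexact hmin i
  obtain ⟨α, hα⟩ := ne_zero_iff.1 hj
  refine ⟨j, ?_⟩
  have hdeg := mem_weightedForms.1 (hM i j) α hα
  have hα0 : α.degree ≠ 0 := fun h => hα <| by
    rw [(Finsupp.degree_eq_zero_iff α).1 h]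
    exact hmin i j
  lia

end GradedMaps

section FreeResolution

variable {σ k ι κ : Type*} [Field k] [Fintype ι] [Fintype κ] {a : ι → ℤ} {b : κ → ℤ}
  {f : ι → MvPolynomial σ k} {M : Matrix ι κ (MvPolynomial σ k)}

lemma finrank_freePiece [Finite σ] (c : ι → ℤ) (d : ℤ) :
    Module.finrank k (freePiece (σ := σ) (R := k) c d) =
      ∑ i, Module.finrank k (weightedForms σ k 1 (d - c i)) :=
  finrank_submodule_pi _

lemma fwdDiff_iter_finrank_freePiece [Fintype σ] (c : ι → ℤ) (d : ℤ) :
    (Δ_[1])^[Fintype.card σ]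
      (fun x : ℤ => (Module.finrank k (freePiece (σ := σ) (R := k) c x) : ℤ)) d =
        (Finset.univ.filter fun i => c i = d + Fintype.card σ).card := by
  have hsum : (fun x : ℤ => (Module.finrank k (freePiece (σ := σ) (R := k) c x) : ℤ)) =
      ∑ i, fun x => (Module.finrank k (weightedForms σ k 1 (x + -c i)) : ℤ) := by
    ext x
    simp only [finrank_freePiece, Nat.cast_sum, Finset.sum_apply]
    rfl
  rw [hsum, fwdDiff_iter_finsetSum, Finset.sum_apply, Finset.card_filter, Nat.cast_sum]
  refine Finset.sum_congr rfl fun i _ => ?_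
  rw [fwdDiff_iter_comp_add 1 fun x => (Module.finrank k (weightedForms σ k 1 x) : ℤ),
    fwdDiff_iter_finrank_weightedForms_one, Nat.cast_ite, Nat.cast_one, Nat.cast_zero]
  exact if_congr (by lia) rfl rfl

variable (hf : ∀ i, f i ∈ weightedForms σ k 1 (a i))
  (hM : ∀ i j, M i j ∈ weightedForms σ k 1 (b j - a i))
  (hexact : Function.Exact M.mulVecLin (Fintype.linearCombination (MvPolynomial σ k) f))
  (hinj : Function.Injective M.mulVecLin)

include hf hM hexact hinj

lemma hilbertFunction_span_add_finrank_freePiece [Finite σ] (d : ℤ) :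
    hilbertFunction (Ideal.span (Set.range f)) d +
        Module.finrank k (freePiece (σ := σ) (R := k) a d) =
      Module.finrank k (weightedForms σ k 1 d) +
        Module.finrank k (freePiece (σ := σ) (R := k) b d) := by
  have hker : ((Fintype.linearCombination (MvPolynomial σ k) f).restrictScalars k).ker =
      (M.mulVecLin.restrictScalars k).range := Submodule.ext hexact
  have hsyz := (Submodule.equivMapOfInjective (M.mulVecLin.restrictScalars k) hinj
    (freePiece b d)).finrank_eq
  have hrank := finrank_map_add_finrank_ker_inf
    ((Fintype.linearCombination (MvPolynomial σ k) f).restrictScalars k) (freePiece a d)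
  rw [hker, ← map_mulVecLin_freePiece hM, map_linearCombination_freePiece hf, ← hsyz] at hrank
  have := hilbertFunction_add_finrank_inf (Ideal.span (Set.range f)) d
  lia

lemma fwdDiff_iter_hilbertFunction_span [Fintype σ] (d : ℤ) :
    (Δ_[1])^[Fintype.card σ] (fun x : ℤ => (hilbertFunction (Ideal.span (Set.range f)) x : ℤ)) d +
        (Finset.univ.filter fun i => a i = d + Fintype.card σ).card =
      (if d + Fintype.card σ = 0 then 1 else 0) +
        (Finset.univ.filter fun j => b j = d + Fintype.card σ).card := by
  rw [← fwdDiff_iter_finrank_freePiece (k := k), ← fwdDiff_iter_finrank_freePiece (k := k),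
    ← fwdDiff_iter_finrank_weightedForms_one (R := k), ← Pi.add_apply, ← Pi.add_apply,
    ← fwdDiff_iter_add, ← fwdDiff_iter_add]
  refine congrFun (congrArg _ (funext fun x => ?_)) d
  rw [Pi.add_apply, Pi.add_apply]
  exact_mod_cast hilbertFunction_span_add_finrank_freePiece hf hM hexact hinj x

end FreeResolution

end Resolution

section MinimalResolution

open scoped fwdDiff

variable {J : Ideal S} {t : ℕ} {a : Fin (t + 1) → ℤ} {b : Fin t → ℤ} {f : Fin (t + 1) → S}
  {M : Matrix (Fin (t + 1)) (Fin t) S} {n : ℤ}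

lemma IsMinimalResolution.defect_add_card (hres : IsMinimalResolution J a b f M)
    (hJ : IsIdealOfZeroDimScheme J) (hn : defect J (n - 2) = 0) {d : ℤ} (hd : n ≤ d) :
    defect J (d - 3) + (Finset.univ.filter fun i => a i = d).card =
      (Finset.univ.filter fun j => b j = d).card := by
  have hzero {e : ℤ} (he : n - 2 ≤ e) : defect J e = 0 :=
    Nat.le_zero.1 (hn ▸ hJ.antitone_defect he)
  have hn2 : 0 ≤ n - 2 := by
    by_contra! hneg
    exact (hJ.defect_pos_of_neg hneg).ne' hn
  obtain ⟨c, -, hc⟩ := hJ.exists_defect_add_hilbertFunction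
  have h := fwdDiff_iter_hilbertFunction_span hres.degree_f hres.degree_M hres.exact
    hres.injective (d - 3)
  rw [hres.span_f, Fintype.card_fin, Nat.cast_ofNat, sub_add_cancel, if_neg (by lia)] at h
  have hs1 : d - 3 + 1 = d - 2 := by ring
  have hs2 : d - 2 + 1 = d - 1 := by ring
  simp only [Function.iterate_succ_apply, Function.iterate_zero_apply, fwdDiff, hs1, hs2,
    sub_add_cancel] at h
  have h3 := hc (d - 3)
  have h2 := hc (d - 2)
  have h1 := hc (d - 1)
  have h0 := hc d
  rw [hzero (by lia)] at h2 h1 h0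
  lia

lemma IsMinimalResolution.degree_bounds (hres : IsMinimalResolution J a b f M)
    (hJ : IsIdealOfZeroDimScheme J) (hn : defect J (n - 2) = 0) :
    (∀ j, b j ≤ n) ∧ ∀ i, a i < n := by
  have hlt (j : Fin t) (i : Fin (t + 1)) : ∃ j', a i < b j' :=
    have : Nontrivial (Fin (t + 1)) := Fin.nontrivial_iff_two_le.2 (by have := j.pos; lia)
    exists_lt_of_exact hres.degree_M hres.exact hres.minimal_M i
  have hsyz {i : Fin (t + 1)} (hi : n ≤ a i) : ∃ j, b j = a i := by
    by_contra! hne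
    have hcard := hres.defect_add_card hJ hn hi
    rw [Finset.filter_eq_empty_iff.2 fun j _ => hne j, Finset.card_empty, Nat.add_eq_zero_iff,
      Finset.card_eq_zero] at hcard
    exact Finset.filter_eq_empty_iff.1 hcard.2 (Finset.mem_univ i) rfl
  have hb (j : Fin t) : b j ≤ n := by
    have : Nonempty (Fin t) := ⟨j⟩
    obtain ⟨l, hl⟩ := Finite.exists_max b
    refine (hl j).trans ?_
    by_contra! hgt
    have hzero : defect J (b l - 3) = 0 := Nat.le_zero.1 (hn ▸ hJ.antitone_defect (by lia))
    have hcard := hres.defect_add_card hJ hn hgt.le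
    have hpos : 0 < (Finset.univ.filter fun i => a i = b l).card := by
      rw [hzero, zero_add] at hcard
      exact hcard ▸ Finset.card_pos.2 ⟨l, Finset.mem_filter.2 ⟨Finset.mem_univ l, rfl⟩⟩
    obtain ⟨i, hi⟩ := Finset.card_pos.1 hpos
    obtain ⟨j', hj'⟩ := hlt l i
    exact ((Finset.mem_filter.1 hi).2 ▸ hj').not_ge (hl j')
  refine ⟨hb, fun i => ?_⟩
  by_contra! hge
  obtain ⟨j, -⟩ := hsyz hge
  obtain ⟨j', hj'⟩ := hlt j i
  exact (hge.trans_lt hj').not_ge (hb j')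

end MinimalResolution

section General

lemma exists_eval_ne_zero_and_eval_ne_zero {σ R : Type*} [CommRing R] [IsDomain R] [Infinite R]
    {P Q : MvPolynomial σ R} {x y : σ → R} (hP : eval x P ≠ 0) (hQ : eval y Q ≠ 0) :
    ∃ s : R, eval (x + s • (y - x)) P ≠ 0 ∧ eval (x + s • (y - x)) Q ≠ 0 := by
  let ρ : MvPolynomial σ R →ₐ[R] Polynomial R :=
    aeval fun i => Polynomial.C (x i) + Polynomial.X * Polynomial.C (y i - x i)
  have hρ (s : R) (A : MvPolynomial σ R) : (ρ A).eval s = eval (x + s • (y - x)) A := by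
    have hcomp : (Polynomial.aeval s).comp ρ = aeval (x + s • (y - x)) :=
      algHom_ext fun i => by simp [ρ]
    exact DFunLike.congr_fun hcomp A
  have hne : ρ P * ρ Q ≠ 0 := by
    refine mul_ne_zero (fun h => hP ?_) fun h => hQ ?_
    · simpa [h] using (hρ 0 P).symm
    · simpa [h] using (hρ 1 Q).symm
  obtain ⟨s, hs⟩ : ∃ s, (ρ P * ρ Q).eval s ≠ 0 := by
    by_contra! h
    exact hne (Polynomial.funext fun s => by rw [h s, Polynomial.eval_zero])
  rw [Polynomial.eval_mul, hρ, hρ] at hs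
  exact ⟨s, ne_zero_and_ne_zero_of_mul hs⟩

variable {m : ℕ} {P Q : (Fin 3 → S) → Prop}

lemma ForGeneral.and (hP : ForGeneral m P) (hQ : ForGeneral m Q) :
    ForGeneral m fun g => P g ∧ Q g := by
  obtain ⟨A, ⟨g₁, hg₁, hA⟩, hAP⟩ := hP
  obtain ⟨B, ⟨g₂, hg₂, hB⟩, hBQ⟩ := hQ
  obtain ⟨s, hs⟩ := exists_eval_ne_zero_and_eval_ne_zero hA hB
  refine ⟨A * B, ⟨g₁ + s • (g₂ - g₁), fun i => ?_, ?_⟩, fun g hg hne => ?_⟩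
  · exact (homogeneousSubmodule _ ℂ m).add_mem (hg₁ i)
      (Submodule.smul_mem _ s (sub_mem (hg₂ i) (hg₁ i)))
  · rw [map_mul]
    exact mul_ne_zero hs.1 hs.2
  · rw [map_mul] at hne
    exact ⟨hAP g hg (left_ne_zero_of_mul hne), hBQ g hg (right_ne_zero_of_mul hne)⟩

lemma ForGeneral.exists (hP : ForGeneral m P) :
    ∃ g : Fin 3 → S, (∀ i, (g i).IsHomogeneous m) ∧ P g :=
  have ⟨_, ⟨g, hg, hne⟩, h⟩ := hP
  ⟨g, hg, h g hg hne⟩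

lemma ForGeneral.mono (hP : ForGeneral m P)
    (h : ∀ g : Fin 3 → S, (∀ i, (g i).IsHomogeneous m) → P g → Q g) : ForGeneral m Q :=
  have ⟨A, hA, hAP⟩ := hP
  ⟨A, hA, fun g hg hne => h g hg (hAP g hg hne)⟩

end General

section MainDegree

open Filter Topology

lemma degree_smallExp {σ : Type*} [Fintype σ] {m : ℕ} (e : σ → Fin m) :
    (smallExp e).degree = ∑ i, (e i : ℕ) :=
  Finsupp.degree_eq_sum _

lemma degree_smallExp_lt {σ : Type*} [Fintype σ] {m : ℕ} {e : σ → Fin m} {i : σ}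
    (hi : (e i : ℕ) ≠ m - 1) : (smallExp e).degree < Fintype.card σ * (m - 1) := by
  rw [degree_smallExp, ← Finset.card_univ, ← smul_eq_mul, ← Finset.sum_const]
  exact Finset.sum_lt_sum (fun j _ => by have := (e j).2; lia)
    ⟨i, Finset.mem_univ i, by have := (e i).2; lia⟩

lemma sq_le_card_degree_smallExp (k : ℕ) :
    k * k ≤ (Finset.univ.filter fun e : Fin 3 → Fin (2 * k) =>
      (smallExp e).degree + 3 = 4 * k).card := by
  let ι : Fin k × Fin k → Fin 3 → Fin (2 * k) := fun p =>
    ![⟨k - 1 + p.1, by lia⟩, ⟨k - 1 + p.2, by lia⟩, ⟨2 * k - 1 - (p.1 + p.2), by lia⟩]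
  have hι : Function.Injective ι := fun p q h => by
    have h0 := congrArg Fin.val (congrFun h 0)
    have h1 := congrArg Fin.val (congrFun h 1)
    simp only [ι, Matrix.cons_val_zero, Matrix.cons_val_one, add_right_inj] at h0 h1
    exact Prod.ext (Fin.ext h0) (Fin.ext h1)
  rw [← Fintype.card_fin k, ← Fintype.card_prod, ← Finset.card_univ, Fintype.card_fin k,
    ← Finset.card_image_of_injective _ hι]
  refine Finset.card_le_card fun e he => ?_
  obtain ⟨p, -, rfl⟩ := Finset.mem_image.1 he
  rw [Finset.mem_filter, degree_smallExp, Fin.sum_univ_three]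
  refine ⟨Finset.mem_univ _, ?_⟩
  have := p.1.2
  have := p.2.2
  simp only [ι, Matrix.cons_val_zero, Matrix.cons_val_one, Matrix.cons_val]
  lia

lemma nonpos_of_sq_mul_le_linear {D A B : ℝ} (h : ∀ k : ℕ, 0 < k → k * k * D ≤ A * k + B) :
    D ≤ 0 := by
  have hlim : Tendsto (fun k : ℕ => A / k + B / k ^ 2) atTop (𝓝 0) := by
    simpa using (tendsto_const_div_atTop_nhds_zero_nat A).add
      (tendsto_const_div_pow B 2 two_ne_zero)
  refine ge_of_tendsto hlim ((eventually_gt_atTop 0).mono fun k hk => ?_)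
  have hk' : (0 : ℝ) < k := Nat.cast_pos.2 hk
  rw [← mul_le_mul_iff_right₀ (mul_pos hk' hk')]
  refine (h k hk).trans_eq ?_
  field_simp

variable {J : Ideal S} {n : ℤ}

lemma IsIdealOfZeroDimScheme.sq_mul_defect_le (hJ : IsIdealOfZeroDimScheme J) {k : ℕ}
    (hk : 0 < k) {g : Fin 3 → S} (hg : ∀ i, (g i).IsHomogeneous (2 * k))
    (hb : Function.Bijective (assemble (2 * k) g)) (n : ℤ) :
    k * k * defect J (n - 2) ≤ defect (pullback g J) ((2 * k : ℕ) * n - 3) := by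
  have : NeZero (2 * k) := ⟨by lia⟩
  rw [hJ.defect_pullback hg hb]
  refine (Nat.mul_le_mul_right _ (sq_le_card_degree_smallExp k)).trans ?_
  rw [← smul_eq_mul, ← Finset.sum_const]
  refine (Finset.sum_le_sum fun e he => ?_).trans
    (Finset.sum_le_sum_of_subset (Finset.subset_univ _))
  have hdeg : (2 * k : ℕ) * n - 3 - (smallExp e).degree = (2 * k : ℕ) * (n - 2) := by
    have := (Finset.mem_filter.1 he).2
    push_cast
    lia
  rw [hdeg, if_pos (dvd_mul_right _ _), Int.mul_ediv_cancel_left _ (by lia)]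

lemma IsIdealOfZeroDimScheme.defect_eq_zero_of_forGeneral (hJ : IsIdealOfZeroDimScheme J)
    {α β : ℝ} (hbound : ∀ m : ℕ, 0 < m → ForGeneral m fun g =>
      (defect (pullback g J) (m * n - 3) : ℝ) ≤ α * m + β) : defect J (n - 2) = 0 := by
  have hle : (defect J (n - 2) : ℝ) ≤ 0 := by
    refine nonpos_of_sq_mul_le_linear (A := 2 * α) (B := β) fun k hk => ?_
    have : NeZero (2 * k) := ⟨by lia⟩
    obtain ⟨g, hg, hδ, hb⟩ :=
      ((hbound (2 * k) (by lia)).and (forGeneral_bijective_assemble (2 * k))).exists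
    calc (k * k * defect J (n - 2) : ℝ) ≤ defect (pullback g J) ((2 * k : ℕ) * n - 3) := by
          exact_mod_cast hJ.sq_mul_defect_le hk hg hb n
      _ ≤ α * (2 * k : ℕ) + β := hδ
      _ = 2 * α * k + β := by push_cast; ring
  exact_mod_cast hle.antisymm (Nat.cast_nonneg _)

lemma IsIdealOfZeroDimScheme.defect_pullback_eq (hJ : IsIdealOfZeroDimScheme J)
    (hn : defect J (n - 2) = 0) {m : ℕ} [NeZero m] {g : Fin 3 → S}
    (hg : ∀ i, (g i).IsHomogeneous m) (hb : Function.Bijective (assemble m g)) :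
    defect (pullback g J) (m * n - 3) = defect J (n - 3) := by
  have hm : 0 < m := NeZero.pos m
  let top : Fin 3 → Fin m := fun _ => ⟨m - 1, Nat.sub_lt hm one_pos⟩
  rw [hJ.defect_pullback hg hb, Fintype.sum_eq_single top fun e he => ?_]
  · have hdeg : m * n - 3 - (smallExp top).degree = m * (n - 3) := by
      rw [degree_smallExp, Fin.sum_univ_three]
      push_cast [top, Nat.cast_sub (Nat.one_le_of_lt hm)]
      ring
    rw [hdeg, if_pos (dvd_mul_right _ _), Int.mul_ediv_cancel_left _ (by lia)]
  · rw [ite_eq_right_iff]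
    rintro ⟨q, hq⟩
    rw [hq, Int.mul_ediv_cancel_left _ (by lia)]
    obtain ⟨i, hi⟩ := Function.ne_iff.1 he
    have hlt := degree_smallExp_lt (Fin.val_ne_of_ne hi)
    rw [Fintype.card_fin] at hlt
    refine Nat.le_zero.1 (hn ▸ hJ.antitone_defect ?_)
    have hq' : (m : ℤ) * (n - q) < m * 3 := by
      rw [mul_sub]
      lia
    have := lt_of_mul_lt_mul_left hq' (Nat.cast_nonneg m)
    lia

end MainDegree

end PlaneScheme

end

theorem mainTheorem9 (J : Ideal PlaneScheme.S) (hJ : PlaneScheme.IsIdealOfZeroDimScheme J)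
    {t : ℕ} (a : Fin (t + 1) → ℤ) (b : Fin t → ℤ)
    (f : Fin (t + 1) → PlaneScheme.S) (M : Matrix (Fin (t + 1)) (Fin t) PlaneScheme.S)
    (hres : PlaneScheme.IsMinimalResolution J a b f M)
    (n : ℤ) (α β : ℝ)
    (hbound : ∀ m : ℕ, 0 < m → PlaneScheme.ForGeneral m fun g =>
      (PlaneScheme.defect (PlaneScheme.pullback g J) (m * n - 3) : ℝ) ≤ α * m + β) :
    (∀ j, b j ≤ n) ∧ (∀ i, a i < n) ∧
      ∀ m : ℕ, 0 < m → PlaneScheme.ForGeneral m fun g =>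
        PlaneScheme.defect (PlaneScheme.pullback g J) (m * n - 3) =
          (Finset.univ.filter fun j => b j = n).card := by
  have hn := hJ.defect_eq_zero_of_forGeneral hbound
  obtain ⟨hb, ha⟩ := hres.degree_bounds hJ hn
  refine ⟨hb, ha, fun m hm => ?_⟩
  have : NeZero m := ⟨hm.ne'⟩
  have hcard := hres.defect_add_card hJ hn le_rfl
  rw [Finset.filter_eq_empty_iff.2 fun i _ => (ha i).ne, Finset.card_empty, add_zero] at hcard
  exact (PlaneScheme.forGeneral_bijective_assemble m).mono fun g hg hbij =>
    (hJ.defect_pullback_eq hn hg hbij).trans hcard
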